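/- **Setting.** Let $d\ge 2$ and let $\Gamma=(V,\mathcal E)$ be an infinite connected graph, possibly with loops and multiple edges. Each unoriented edge gives two oppositely oriented edges, and $\mathcal A$ denotes the set of oriented edges. The degree $\varkappa_v$ is the number of edges in $\mathcal A$ starting at $v$. Assume that $\Gamma$ is $\mathbb Z^d$-periodic: $\mathbb Z^d$ acts on $\Gamma$ by graph automorphisms, freely on $V$, all degrees are finite, and the quotient graph $\Gamma_*=\Gamma/\mathbb Z^d$, with vertex set $V_*$ and oriented edge set $\mathcal A_*$, is finite. Let $Q:V\to\mathbb R$ satisfy $Q(v+m)=Q(v)$ for all $v\in V$, $m\in\mathbb Z^d$, and let $H=\Delta+Q$ on $\ell^2(V)$, where $$(\Delta f)(v)=f(v)-\sum_{(v,u)\in\mathcal A}\frac{f(u)}{\sqrt{\varkappa_v\varkappa_u}} .$$ Fix a set $V_0\subset V$ containing exactly one vertex of each $\mathbb Z^d$-orbit, and write $v=v_0+[v]$ with $v_0\in V_0$, $[v]\in\mathbb Z^d$. The index of an edge $\mathbf e=(u,v)\in\mathcal A$ is $\tau(\mathbf e)=[v]-[u]$; it depends only on the class of $\mathbf e$ in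 $\mathcal A_*$. For $\vartheta\in\mathbb T^d=\mathbb R^d/(2\pi\mathbb Z)^d$ the fiber operators on $\ell^2(V_*)$ are $H(\vartheta)=\Delta(\vartheta)+Q$ and $$(\Delta(\vartheta)f)(v)=f(v)-\sum_{\mathbf e=(v,u)\in\mathcal A_*}\frac{e^{i\langle\tau(\mathbf e),\vartheta\rangle}}{\sqrt{\varkappa_v\varkappa_u}}\,f(u),\qquad v\in V_* .$$ Let $\lambda_1(\vartheta)$ be the lowest eigenvalue of $H(\vartheta)$. The first spectral band of $H$ is $\sigma_1(H)=[\lambda_1^-,\lambda_1^+]=\lambda_1(\mathbb T^d)$, and $|\cdot|$ denotes Lebesgue measure. Let $M=\big(\partial^2\lambda_1(0)/\partial\vartheta_i\partial\vartheta_j\big)_{i,j=1}^d$. The effective mass tensor of $H$ at the bottom of the spectrum is $m=M^{-1}$. Let $\sigma_1(\Delta)$ and $m_0$ be the corresponding objects for $Q=0$. **Theorem.** i) The lowest eigenvalue $\lambda_1(0)$ of $H(0)$ is simple and has an eigenvector $\psi\in\ell^2(V_*)$ with positive components. ii) The first spectral band $\sigma_1(H)=[\lambda_1^-,\lambda_1^+]$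 is non-degenerate, i.e. $\lambda_1^-<\lambda_1^+$, and $$c_0^{-2}\,|\sigma_1(\Delta)|\le|\sigma_1(H)|\le c_0^{2}\,|\sigma_1(\Delta)|,\qquad c_0=\frac{\psi_+}{\psi_-},\quad \psi_-=\min_{v\in V_*}\frac{\psi(v)}{\sqrt{\varkappa_v}},\quad \psi_+=\max_{v\in V_*}\frac{\psi(v)}{\sqrt{\varkappa_v}} .$$ iii) The function $\lambda_1$ is three times continuously differentiable near $\vartheta=0$ and $M$ is invertible, both for $H$ and for $\Delta$, and the effective mass tensors satisfy $$c_0^{-2}\,m_0\le m\le c_0^{2}\,m_0$$ in the sense of quadratic forms. -/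

import Mathlib

noncomputable section

/-- A connected, locally finite, `ℤ^d`-periodic graph, possibly with loops and multiple edges.
`V` is the set of vertices and `A` the set of oriented edges: an unoriented edge (in particular a
loop) is a pair `{e, rev e}` of two distinct, mutually opposite oriented edges. The group `ℤ^d`
acts by graph automorphisms, freely on the vertices, with finite quotient graph. -/
structure PeriodicGraph (d : ℕ) (V A : Type*)
    [AddAction (Fin d → ℤ) V] [AddAction (Fin d → ℤ) A] where
  /-- the initial vertex of an oriented edge -/
  src : A → V
  /-- the terminal vertex of an oriented edge -/
  tgt : A → V
  /-- the opposite oriented edge -/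
  rev : A → A
  rev_rev : ∀ e, rev (rev e) = e
  rev_ne : ∀ e, rev e ≠ e
  src_rev : ∀ e, src (rev e) = tgt e
  src_vadd : ∀ (m : Fin d → ℤ) (e : A), src (m +ᵥ e) = m +ᵥ src e
  tgt_vadd : ∀ (m : Fin d → ℤ) (e : A), tgt (m +ᵥ e) = m +ᵥ tgt e
  rev_vadd : ∀ (m : Fin d → ℤ) (e : A), rev (m +ᵥ e) = m +ᵥ rev e
  free : ∀ (m : Fin d → ℤ) (v : V), m +ᵥ v = v → m = 0
  nonempty : Nonempty V
  connected : ∀ u v : V, Relation.ReflTransGen (fun a b => ∃ e, src e = a ∧ tgt e = b) u v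
  locallyFinite : ∀ v : V, {e : A | src e = v}.Finite
  finite_vertices : Finite (AddAction.orbitRel.Quotient (Fin d → ℤ) V)
  finite_edges : Finite (AddAction.orbitRel.Quotient (Fin d → ℤ) A)

namespace PeriodicGraph

variable {d : ℕ} {V A : Type*} [AddAction (Fin d → ℤ) V] [AddAction (Fin d → ℤ) A]

/-! ### The graph, its Laplacian and Schrödinger operator -/

/-- The set of oriented edges starting at `v`. -/
def star (G : PeriodicGraph d V A) (v : V) : Finset A := (G.locallyFinite v).toFinset

theorem mem_star (G : PeriodicGraph d V A) {v : V} {e : A} : e ∈ G.star v ↔ G.src e = v := by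
  simp [star]

/-- The degree `κ_v`: the number of oriented edges starting at `v` (a loop counts twice). -/
def degree (G : PeriodicGraph d V A) (v : V) : ℕ := (G.star v).card

theorem degree_vadd (G : PeriodicGraph d V A) (m : Fin d → ℤ) (v : V) :
    G.degree (m +ᵥ v) = G.degree v := by
  unfold degree
  refine (Finset.card_bij (fun e _ => m +ᵥ e) ?_ ?_ ?_).symm
  · intro e he
    rw [mem_star] at he ⊢
    rw [G.src_vadd, he]
  · intro a _ b _ h
    exact AddAction.injective m h
  · intro e he
    rw [mem_star] at he
    refine ⟨-m +ᵥ e, ?_, ?_⟩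
    · rw [mem_star, G.src_vadd, he, neg_vadd_vadd]
    · rw [vadd_neg_vadd]

/-- A real `ℤ^d`-periodic potential on the vertices. -/
structure Potential (_G : PeriodicGraph d V A) where
  /-- the values of the potential -/
  toFun : V → ℝ
  periodic : ∀ (m : Fin d → ℤ) (v : V), toFun (m +ᵥ v) = toFun v

/-- The zero potential. -/
def Potential.zero (G : PeriodicGraph d V A) : G.Potential := ⟨fun _ => 0, fun _ _ => rfl⟩

/-- The normalized Laplacian `(Δ f)(v) = f(v) - ∑_{(v,u) ∈ A} f(u) / √(κ_v κ_u)`. -/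
def laplacian (G : PeriodicGraph d V A) (f : V → ℂ) (v : V) : ℂ :=
  f v - ∑ e ∈ G.star v,
    f (G.tgt e) / (Real.sqrt ((G.degree v : ℝ) * (G.degree (G.tgt e) : ℝ)) : ℂ)

/-- The Schrödinger operator `H = Δ + Q`. -/
def schrodinger (G : PeriodicGraph d V A) (Q : G.Potential) (f : V → ℂ) (v : V) : ℂ :=
  G.laplacian f v + (Q.toFun v : ℂ) * f v

/-! ### The fundamental (quotient) graph -/

/-- The vertices `V_* = V / ℤ^d` of the fundamental graph. -/
def QVertex (_G : PeriodicGraph d V A) : Type _ := AddAction.orbitRel.Quotient (Fin d → ℤ) V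

/-- The oriented edges `A_* = A / ℤ^d` of the fundamental graph. -/
def QEdge (_G : PeriodicGraph d V A) : Type _ := AddAction.orbitRel.Quotient (Fin d → ℤ) A

instance (G : PeriodicGraph d V A) : Finite G.QVertex := G.finite_vertices

instance (G : PeriodicGraph d V A) : Finite G.QEdge := G.finite_edges

instance (G : PeriodicGraph d V A) : Fintype G.QVertex := Fintype.ofFinite _

instance (G : PeriodicGraph d V A) : Fintype G.QEdge := Fintype.ofFinite _

/-- The class of a vertex. -/
def mkV (G : PeriodicGraph d V A) (v : V) : G.QVertex :=
  Quotient.mk (AddAction.orbitRel (Fin d → ℤ) V) v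

/-- The class of an oriented edge. -/
def mkE (G : PeriodicGraph d V A) (e : A) : G.QEdge :=
  Quotient.mk (AddAction.orbitRel (Fin d → ℤ) A) e

instance (G : PeriodicGraph d V A) : Nonempty G.QVertex := G.nonempty.map G.mkV

theorem mkV_eq (G : PeriodicGraph d V A) {u v : V} :
    G.mkV u = G.mkV v ↔ ∃ m : Fin d → ℤ, m +ᵥ v = u := by
  exact Quotient.eq.trans (AddAction.orbitRel_apply.trans AddAction.mem_orbit_iff)

theorem mkE_eq (G : PeriodicGraph d V A) {a b : A} :
    G.mkE a = G.mkE b ↔ ∃ m : Fin d → ℤ, m +ᵥ b = a := by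
  exact Quotient.eq.trans (AddAction.orbitRel_apply.trans AddAction.mem_orbit_iff)

/-- A `ℤ^d`-invariant function on vertices, as a function on `V_*`. -/
def descendV {β : Type*} (G : PeriodicGraph d V A) (F : V → β)
    (hF : ∀ (m : Fin d → ℤ) (v : V), F (m +ᵥ v) = F v) : G.QVertex → β :=
  Quotient.lift F (by
    intro a b h
    obtain ⟨m, rfl⟩ := AddAction.mem_orbit_iff.1 (AddAction.orbitRel_apply.1 h)
    exact hF m b)

/-- A `ℤ^d`-invariant function on oriented edges, as a function on `A_*`. -/
def descendE {β : Type*} (G : PeriodicGraph d V A) (F : A → β)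
    (hF : ∀ (m : Fin d → ℤ) (e : A), F (m +ᵥ e) = F e) : G.QEdge → β :=
  Quotient.lift F (by
    intro a b h
    obtain ⟨m, rfl⟩ := AddAction.mem_orbit_iff.1 (AddAction.orbitRel_apply.1 h)
    exact hF m b)

/-- The initial vertex of an oriented edge of the fundamental graph. -/
def qsrc (G : PeriodicGraph d V A) : G.QEdge → G.QVertex :=
  G.descendE (fun e => G.mkV (G.src e)) (fun m e => G.mkV_eq.2 ⟨m, (G.src_vadd m e).symm⟩)

/-- The terminal vertex of an oriented edge of the fundamental graph. -/
def qtgt (G : PeriodicGraph d V A) : G.QEdge → G.QVertex :=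
  G.descendE (fun e => G.mkV (G.tgt e)) (fun m e => G.mkV_eq.2 ⟨m, (G.tgt_vadd m e).symm⟩)

/-- The degree `κ_v` as a function of `v ∈ V_*`. -/
def qdegree (G : PeriodicGraph d V A) : G.QVertex → ℕ := G.descendV G.degree G.degree_vadd

/-- The potential as a function on `V_*`. -/
def Potential.onQuotient {G : PeriodicGraph d V A} (Q : G.Potential) : G.QVertex → ℝ :=
  G.descendV Q.toFun Q.periodic

/-! ### Coordinates of vertices and indices of edges -/

/-- A fundamental vertex set `V₀ ⊆ V`, given as the choice of one vertex in each class. -/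
structure FundamentalSet (G : PeriodicGraph d V A) where
  /-- the vertex of `V₀` in a given class -/
  rep : G.QVertex → V
  mkV_rep : ∀ x, G.mkV (rep x) = x

variable {G : PeriodicGraph d V A}

theorem FundamentalSet.exists_coord (S : G.FundamentalSet) (v : V) :
    ∃ m : Fin d → ℤ, m +ᵥ S.rep (G.mkV v) = v :=
  G.mkV_eq.1 (S.mkV_rep (G.mkV v)).symm

/-- The coordinates `[v] ∈ ℤ^d` of `v` with respect to `V₀`: `v = v₀ + [v]` with `v₀ ∈ V₀`. -/
def FundamentalSet.coord (S : G.FundamentalSet) (v : V) : Fin d → ℤ :=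
  Classical.choose (S.exists_coord v)

theorem FundamentalSet.coord_vadd_rep (S : G.FundamentalSet) (v : V) :
    S.coord v +ᵥ S.rep (G.mkV v) = v :=
  Classical.choose_spec (S.exists_coord v)

theorem FundamentalSet.coord_vadd (S : G.FundamentalSet) (m : Fin d → ℤ) (v : V) :
    S.coord (m +ᵥ v) = m + S.coord v := by
  have h1 := S.coord_vadd_rep (m +ᵥ v)
  have h2 : G.mkV (m +ᵥ v) = G.mkV v := G.mkV_eq.2 ⟨m, rfl⟩
  rw [h2] at h1
  have h3 : (m + S.coord v) +ᵥ S.rep (G.mkV v) = m +ᵥ v := by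
    rw [add_vadd, S.coord_vadd_rep]
  have h4 := G.free (-(m + S.coord v) + S.coord (m +ᵥ v)) (S.rep (G.mkV v)) (by
    rw [add_vadd, h1, ← h3, neg_vadd_vadd])
  exact (neg_add_eq_zero.1 h4).symm

/-- The index `τ(e) = [v] - [u]` of an oriented edge `e = (u, v)` of the periodic graph. -/
def FundamentalSet.index (S : G.FundamentalSet) (e : A) : Fin d → ℤ :=
  S.coord (G.tgt e) - S.coord (G.src e)

theorem FundamentalSet.index_vadd (S : G.FundamentalSet) (m : Fin d → ℤ) (e : A) :
    S.index (m +ᵥ e) = S.index e := by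
  unfold FundamentalSet.index
  rw [G.tgt_vadd, G.src_vadd, S.coord_vadd, S.coord_vadd, add_sub_add_left_eq_sub]

/-- The index `τ(e)` of an oriented edge of the fundamental graph. -/
def FundamentalSet.qindex (S : G.FundamentalSet) : G.QEdge → (Fin d → ℤ) :=
  G.descendE S.index S.index_vadd

/-- The pairing `⟨n, θ⟩` of `n ∈ ℤ^d` and `θ ∈ ℝ^d`. -/
def pairing (n : Fin d → ℤ) (θ : Fin d → ℝ) : ℝ := ∑ i, (n i : ℝ) * θ i

/-! ### Fiber operators -/

open Classical in
/-- The fiber Laplacian on `ℓ²(V_*)`: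
`(Δ(θ) f)(v) = f(v) - ∑_{e = (v,u) ∈ A_*} e^{i⟨τ(e), θ⟩} f(u) / √(κ_v κ_u)`. -/
def FundamentalSet.fiberLaplacian (S : G.FundamentalSet) (θ : Fin d → ℝ) :
    Module.End ℂ (G.QVertex → ℂ) where
  toFun f v := f v - ∑ e : G.QEdge with G.qsrc e = v,
    Complex.exp (Complex.I * (pairing (S.qindex e) θ : ℂ)) /
      (Real.sqrt ((G.qdegree v : ℝ) * (G.qdegree (G.qtgt e) : ℝ)) : ℂ) * f (G.qtgt e)
  map_add' f g := by
    funext v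
    simp only [Pi.add_apply, mul_add, Finset.sum_add_distrib]
    ring
  map_smul' c f := by
    funext v
    simp only [Pi.smul_apply, smul_eq_mul, RingHom.id_apply, mul_sub, Finset.mul_sum]
    congr 1
    exact Finset.sum_congr rfl fun e _ => by ring

/-- The fiber Schrödinger operator `H(θ) = Δ(θ) + Q` on `ℓ²(V_*)`. -/
def FundamentalSet.fiber (S : G.FundamentalSet) (Q : G.Potential) (θ : Fin d → ℝ) :
    Module.End ℂ (G.QVertex → ℂ) :=
  S.fiberLaplacian θ + LinearMap.pi fun v => (Q.onQuotient v : ℂ) • LinearMap.proj v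

/-- The Floquet extension of `g ∈ ℓ²(V_*)`, that is the function on `V` which satisfies
`f(v + m) = e^{i⟨m, θ⟩} f(v)` and coincides with `g` on `V₀`. -/
def FundamentalSet.extend (S : G.FundamentalSet) (θ : Fin d → ℝ) (g : G.QVertex → ℂ) (v : V) : ℂ :=
  Complex.exp (Complex.I * (pairing (S.coord v) θ : ℂ)) * g (G.mkV v)

/-- `H(θ)` is the action of `H` on the functions of quasi-momentum `θ`. -/
theorem FundamentalSet.schrodinger_extend (S : G.FundamentalSet) (Q : G.Potential)
    (θ : Fin d → ℝ) (g : G.QVertex → ℂ) (v : V) :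
    G.schrodinger Q (S.extend θ g) v = S.extend θ (S.fiber Q θ g) v := by
  classical
  have hsum : ∑ e ∈ G.star v, S.extend θ g (G.tgt e) /
        (Real.sqrt ((G.degree v : ℝ) * (G.degree (G.tgt e) : ℝ)) : ℂ) =
      Complex.exp (Complex.I * (pairing (S.coord v) θ : ℂ)) *
        ∑ e : G.QEdge with G.qsrc e = G.mkV v,
          Complex.exp (Complex.I * (pairing (S.qindex e) θ : ℂ)) /
          (Real.sqrt ((G.qdegree (G.mkV v) : ℝ) * (G.qdegree (G.qtgt e) : ℝ)) : ℂ) *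
            g (G.qtgt e) := by
    rw [Finset.mul_sum]
    refine Finset.sum_bij (fun e _ => G.mkE e) ?_ ?_ ?_ ?_
    · intro e he
      rw [mem_star] at he
      rw [Finset.mem_filter]
      exact ⟨Finset.mem_univ _, congrArg G.mkV he⟩
    · intro a ha b hb h
      rw [mem_star] at ha hb
      obtain ⟨m, rfl⟩ := G.mkE_eq.1 h
      have : m = 0 := G.free m v (by rw [← hb, ← G.src_vadd, ha, hb])
      rw [this, zero_vadd]
    · intro x hx
      obtain ⟨e, rfl⟩ := Quotient.exists_rep x
      have h1 : G.mkV (G.src e) = G.mkV v := (Finset.mem_filter.1 hx).2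
      obtain ⟨m, hm⟩ := G.mkV_eq.1 h1
      refine ⟨-m +ᵥ e, ?_, ?_⟩
      · rw [mem_star, G.src_vadd, ← hm, neg_vadd_vadd]
      · exact G.mkE_eq.2 ⟨-m, rfl⟩
    · intro e he
      rw [mem_star] at he
      have h1 : S.qindex (G.mkE e) = S.coord (G.tgt e) - S.coord v := by
        rw [← he]; rfl
      have h2 : (pairing (S.coord (G.tgt e)) θ : ℂ) =
          (pairing (S.coord v) θ : ℂ) + (pairing (S.coord (G.tgt e) - S.coord v) θ : ℂ) := by
        rw [← Complex.ofReal_add]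
        congr 1
        simp only [pairing, ← Finset.sum_add_distrib]
        exact Finset.sum_congr rfl fun i _ => by simp only [Pi.sub_apply]; push_cast; ring
      have h3 : G.qtgt (G.mkE e) = G.mkV (G.tgt e) := rfl
      have h4 : G.qdegree (G.mkV v) = G.degree v := rfl
      have h5 : G.qdegree (G.mkV (G.tgt e)) = G.degree (G.tgt e) := rfl
      rw [h1, h3, h4, h5, FundamentalSet.extend, h2, mul_add, Complex.exp_add]
      ring
  have hQ : Q.onQuotient (G.mkV v) = Q.toFun v := rfl
  have hfib : S.fiber Q θ g (G.mkV v) = (g (G.mkV v) -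
      ∑ e : G.QEdge with G.qsrc e = G.mkV v,
          Complex.exp (Complex.I * (pairing (S.qindex e) θ : ℂ)) /
          (Real.sqrt ((G.qdegree (G.mkV v) : ℝ) * (G.qdegree (G.qtgt e) : ℝ)) : ℂ) *
            g (G.qtgt e)) + (Q.toFun v : ℂ) * g (G.mkV v) := by
    rw [← hQ]
    simp only [FundamentalSet.fiber, FundamentalSet.fiberLaplacian, LinearMap.add_apply,
      Pi.add_apply, LinearMap.coe_mk, AddHom.coe_mk, LinearMap.pi_apply, LinearMap.smul_apply,
      LinearMap.proj_apply, smul_eq_mul]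
  rw [schrodinger, laplacian, hsum, FundamentalSet.extend, FundamentalSet.extend, hfib]
  ring

/-! ### The first band and the effective mass tensor -/

/-- The set of (real) eigenvalues of the self-adjoint operator `H(θ)`. -/
def FundamentalSet.eigenvalues (S : G.FundamentalSet) (Q : G.Potential) (θ : Fin d → ℝ) : Set ℝ :=
  {t | (S.fiber Q θ).HasEigenvalue (t : ℂ)}

/-- The first band function: `λ₁(θ)` is the lowest eigenvalue of `H(θ)`. -/
def FundamentalSet.lowest (S : G.FundamentalSet) (Q : G.Potential) (θ : Fin d → ℝ) : ℝ :=
  sInf (S.eigenvalues Q θ)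

/-- The first spectral band `σ₁(H) = λ₁(𝕋^d)`. -/
def FundamentalSet.firstBand (S : G.FundamentalSet) (Q : G.Potential) : Set ℝ :=
  Set.range (S.lowest Q)

/-- The length (Lebesgue measure) `|σ₁(H)|` of the first spectral band. -/
def FundamentalSet.firstBandLength (S : G.FundamentalSet) (Q : G.Potential) : ℝ :=
  MeasureTheory.volume.real (S.firstBand Q)

/-- The matrix `M_{ij} = ∂²λ₁(0) / ∂θ_i ∂θ_j`. -/
def FundamentalSet.massHessian (S : G.FundamentalSet) (Q : G.Potential) :
    Matrix (Fin d) (Fin d) ℝ :=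
  Matrix.of fun i j =>
    fderiv ℝ (fun θ => fderiv ℝ (S.lowest Q) θ (Pi.single j 1)) 0 (Pi.single i 1)

/-- The effective mass tensor `m = M⁻¹` at the bottom of the spectrum. -/
def FundamentalSet.effectiveMass (S : G.FundamentalSet) (Q : G.Potential) :
    Matrix (Fin d) (Fin d) ℝ :=
  (S.massHessian Q)⁻¹

/-- `ψ` is an eigenvector of `H(0)` for `λ₁(0)` with positive components. -/
def FundamentalSet.IsPositiveGroundState (S : G.FundamentalSet) (Q : G.Potential)
    (ψ : G.QVertex → ℝ) : Prop :=
  (∀ v, 0 < ψ v) ∧ (S.fiber Q 0).HasEigenvector (S.lowest Q 0 : ℂ) (fun v => (ψ v : ℂ))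

/-- `ψ₋ = min_v ψ(v) / √κ_v`. -/
def psiMinus (G : PeriodicGraph d V A) (ψ : G.QVertex → ℝ) : ℝ :=
  ⨅ v, ψ v / Real.sqrt (G.qdegree v)

/-- `ψ₊ = max_v ψ(v) / √κ_v`. -/
def psiPlus (G : PeriodicGraph d V A) (ψ : G.QVertex → ℝ) : ℝ :=
  ⨆ v, ψ v / Real.sqrt (G.qdegree v)

/-- `c₀ = ψ₊ / ψ₋`. -/
def cZero (G : PeriodicGraph d V A) (ψ : G.QVertex → ℝ) : ℝ := G.psiPlus ψ / G.psiMinus ψ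

end PeriodicGraph

end

/-! Let `ψ > 0` be the ground state of `H(0)` and write a trial vector as `f = ψ g`. The eigenvalue
equation absorbs the potential: the form of `H(θ) - λ₁(0)` at `f` becomes half of a weighted
Dirichlet energy, the sum over edges `e = (u, v)` of `ψ(u) ψ(v) / √(κ_u κ_v)` times `|g(u) -
e^{i⟨τ(e), θ⟩} g(v)|²` (`form_eq_energy`), while the norm becomes `∑ ψ² |g|²`. For `Q = 0` the
ground state is `√κ` and every edge weight is `1`.

Two potentials thus differ only through their ground states. Putting the optimal `g` for one into
the Rayleigh quotient of the other costs at most a factor `c₀²`, so `λ₁(θ) - λ₁(0)` for `H` and for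
`Δ` are comparable at every `θ` (`lowest_sub_le`). Maximizing over `θ` compares the band lengths.
Comparing second derivatives at the common minimum `θ = 0` compares the Hessians, and inversion,
which reverses the order, compares the effective masses.

Non-degeneracy is needed only for `Δ`, since the comparison transfers it to `H`. It comes from `c (1
- cos θ_i) ≤ λ₁(θ)` (`exists_le_lowest_zero`): the energy controls the variation of a Floquet
function along a path from a vertex to its translate by the `i`-th basis vector, and that variation
is `|e^{iθ_i} - 1| |g|`.

Positivity and simplicity of the ground state follow from the variational principle and
connectedness. Smoothness near `0` follows from the implicit function theorem for the characteristic
polynomial, of which a simple eigenvalue is a simple root. -/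

/-! ### Lowest eigenvalues of Hermitian matrices. -/

section LinearAlgebra

open Matrix Module.End Filter Topology

variable {n : Type*} [Fintype n] [DecidableEq n]

/-- The set of real eigenvalues of a complex matrix. -/
def Matrix.realEigenvalues (A : Matrix n n ℂ) : Set ℝ :=
  {t | HasEigenvalue (Matrix.toLin' A) (t : ℂ)}

/-- The lowest real eigenvalue of a complex matrix. -/
noncomputable def Matrix.lowestEigenvalue (A : Matrix n n ℂ) : ℝ := sInf A.realEigenvalues

theorem Matrix.mem_realEigenvalues {A : Matrix n n ℂ} {t : ℝ} :
    t ∈ A.realEigenvalues ↔ ∃ x : n → ℂ, x ≠ 0 ∧ A *ᵥ x = (t : ℂ) • x := by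
  constructor
  · intro h
    obtain ⟨x, hx⟩ := h.exists_hasEigenvector
    exact ⟨x, hx.2, by simpa using hx.apply_eq_smul⟩
  · rintro ⟨x, hx, h⟩
    exact hasEigenvalue_of_hasEigenvector
      (hasEigenvector_iff.2 ⟨mem_eigenspace_iff.2 (by simpa using h), hx⟩)

theorem Matrix.finite_realEigenvalues (A : Matrix n n ℂ) : A.realEigenvalues.Finite :=
  (finite_hasEigenvalue (Matrix.toLin' A)).preimage Complex.ofReal_injective.injOn

theorem Matrix.IsHermitian.eigenvalues_mem_realEigenvalues {A : Matrix n n ℂ}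
    (hA : A.IsHermitian) (i : n) : hA.eigenvalues i ∈ A.realEigenvalues := by
  refine mem_realEigenvalues.2 ⟨hA.eigenvectorBasis i, ?_, ?_⟩
  · intro h
    exact hA.eigenvectorBasis.orthonormal.ne_zero i (by ext j; exact congrFun h j)
  · rw [hA.mulVec_eigenvectorBasis]
    rfl

/-- The set of real eigenvalues is finite, and nonempty for a Hermitian matrix, so `sInf` is
attained and is not a default value. -/
theorem Matrix.IsHermitian.isLeast_lowestEigenvalue [Nonempty n] {A : Matrix n n ℂ}
    (hA : A.IsHermitian) : IsLeast A.realEigenvalues A.lowestEigenvalue :=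
  ⟨Set.Nonempty.csInf_mem ⟨_, hA.eigenvalues_mem_realEigenvalues (Classical.arbitrary n)⟩
    A.finite_realEigenvalues, fun _ h => csInf_le A.finite_realEigenvalues.bddBelow h⟩

omit [Fintype n] in
theorem Matrix.isHermitian_sub_real_smul {A : Matrix n n ℂ} (hA : A.IsHermitian) (t : ℝ) :
    (A - (t : ℂ) • (1 : Matrix n n ℂ)).IsHermitian := by
  refine hA.sub ?_
  rw [IsHermitian, conjTranspose_smul, conjTranspose_one]
  simp

open scoped ComplexOrder in
theorem Matrix.IsHermitian.posSemidef_sub_lowestEigenvalue [Nonempty n] {A : Matrix n n ℂ}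
    (hA : A.IsHermitian) : (A - (A.lowestEigenvalue : ℂ) • (1 : Matrix n n ℂ)).PosSemidef := by
  have hB := isHermitian_sub_real_smul hA A.lowestEigenvalue
  refine hB.posSemidef_iff_eigenvalues_nonneg.2 fun i => ?_
  obtain ⟨x, hx, h⟩ := mem_realEigenvalues.1 (hB.eigenvalues_mem_realEigenvalues i)
  have h2 : A.lowestEigenvalue + hB.eigenvalues i ∈ A.realEigenvalues := by
    refine mem_realEigenvalues.2 ⟨x, hx, ?_⟩
    rw [sub_mulVec, smul_mulVec, one_mulVec] at h
    rw [Complex.ofReal_add, add_smul, ← h]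
    abel
  have := hA.isLeast_lowestEigenvalue.2 h2
  simpa using this

theorem Matrix.re_star_dotProduct_sub (A : Matrix n n ℂ) (t : ℝ) (x : n → ℂ) :
    (star x ⬝ᵥ (A - (t : ℂ) • (1 : Matrix n n ℂ)) *ᵥ x).re =
      (star x ⬝ᵥ A *ᵥ x).re - t * ∑ i, ‖x i‖ ^ 2 := by
  have h : (star x ⬝ᵥ x).re = ∑ i, ‖x i‖ ^ 2 := by
    simp only [dotProduct, Complex.re_sum, Pi.star_apply, RCLike.star_def]
    refine Finset.sum_congr rfl fun i _ => ?_
    rw [Complex.conj_mul']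
    norm_cast
  rw [sub_mulVec, smul_mulVec, one_mulVec, dotProduct_sub, dotProduct_smul, Complex.sub_re,
    smul_eq_mul, Complex.re_ofReal_mul, h]

/-- The Rayleigh principle. -/
theorem Matrix.IsHermitian.lowestEigenvalue_mul_le [Nonempty n] {A : Matrix n n ℂ}
    (hA : A.IsHermitian) (x : n → ℂ) :
    A.lowestEigenvalue * ∑ i, ‖x i‖ ^ 2 ≤ (star x ⬝ᵥ A *ᵥ x).re := by
  have := hA.posSemidef_sub_lowestEigenvalue.re_dotProduct_nonneg x
  rw [RCLike.re_eq_complex_re, re_star_dotProduct_sub] at this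
  linarith

open scoped ComplexOrder in
/-- Minimizers of the Rayleigh quotient are eigenvectors. -/
theorem Matrix.IsHermitian.mulVec_eq_of_rayleigh_le [Nonempty n] {A : Matrix n n ℂ}
    (hA : A.IsHermitian) (x : n → ℂ)
    (h : (star x ⬝ᵥ A *ᵥ x).re ≤ A.lowestEigenvalue * ∑ i, ‖x i‖ ^ 2) :
    A *ᵥ x = (A.lowestEigenvalue : ℂ) • x := by
  have hB := hA.posSemidef_sub_lowestEigenvalue
  have h0 := hB.dotProduct_mulVec_nonneg x
  have h1 := re_star_dotProduct_sub A A.lowestEigenvalue x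
  have h2 : star x ⬝ᵥ (A - (A.lowestEigenvalue : ℂ) • (1 : Matrix n n ℂ)) *ᵥ x = 0 := by
    have h3 := Complex.nonneg_iff.1 h0
    exact Complex.ext (le_antisymm (by rw [h1, Complex.zero_re]; linarith) h3.1) h3.2.symm
  have h4 := (hB.dotProduct_mulVec_zero_iff x).1 h2
  rwa [sub_mulVec, smul_mulVec, one_mulVec, sub_eq_zero] at h4

theorem Matrix.star_dotProduct_mulVec_of_eigen {A : Matrix n n ℂ} {t : ℝ} {x : n → ℂ}
    (h : A *ᵥ x = (t : ℂ) • x) : (star x ⬝ᵥ A *ᵥ x).re = t * ∑ i, ‖x i‖ ^ 2 := by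
  have := re_star_dotProduct_sub A t x
  have h0 : (A - (t : ℂ) • (1 : Matrix n n ℂ)) *ᵥ x = 0 := by
    rw [sub_mulVec, h, smul_mulVec, one_mulVec, sub_self]
  rw [h0, dotProduct_zero, Complex.zero_re] at this
  linarith

omit [DecidableEq n] in
theorem sum_norm_sq_pos {x : n → ℂ} (hx : x ≠ 0) : 0 < ∑ i, ‖x i‖ ^ 2 := by
  obtain ⟨i, hi⟩ := Function.ne_iff.1 hx
  exact Finset.sum_pos' (fun _ _ => by positivity) ⟨i, Finset.mem_univ _, by
    have : 0 < ‖x i‖ := norm_pos_iff.2 hi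
    positivity⟩

omit [DecidableEq n] in
-- A crude bound; what matters is that the constant tends to zero with the entries.
theorem Matrix.abs_re_star_dotProduct_mulVec_le (A : Matrix n n ℂ) (x : n → ℂ) :
    |(star x ⬝ᵥ A *ᵥ x).re| ≤ (∑ i, ∑ j, ‖A i j‖) * ∑ i, ‖x i‖ ^ 2 := by
  refine (Complex.abs_re_le_norm _).trans ?_
  simp only [dotProduct, mulVec, Finset.sum_mul, Pi.star_apply]
  refine (norm_sum_le _ _).trans (Finset.sum_le_sum fun i _ => ?_)
  rw [Finset.mul_sum]
  refine (norm_sum_le _ _).trans (Finset.sum_le_sum fun j _ => ?_)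
  rw [norm_mul, norm_mul, norm_star]
  have hi : ‖x i‖ ^ 2 ≤ ∑ k, ‖x k‖ ^ 2 :=
    Finset.single_le_sum (f := fun k => ‖x k‖ ^ 2) (fun _ _ => by positivity) (Finset.mem_univ i)
  have hj : ‖x j‖ ^ 2 ≤ ∑ k, ‖x k‖ ^ 2 :=
    Finset.single_le_sum (f := fun k => ‖x k‖ ^ 2) (fun _ _ => by positivity) (Finset.mem_univ j)
  have h : ‖x i‖ * ‖x j‖ ≤ ∑ k, ‖x k‖ ^ 2 := by nlinarith [sq_nonneg (‖x i‖ - ‖x j‖)]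
  calc ‖x i‖ * (‖A i j‖ * ‖x j‖) = ‖A i j‖ * (‖x i‖ * ‖x j‖) := by ring
    _ ≤ _ := by gcongr

/-- A lowest eigenvector of `A` serves as trial vector for `B`. Exchanging the roles gives
continuity. -/
theorem Matrix.IsHermitian.lowestEigenvalue_sub_le [Nonempty n] {A B : Matrix n n ℂ}
    (hA : A.IsHermitian) (hB : B.IsHermitian) :
    B.lowestEigenvalue - A.lowestEigenvalue ≤ ∑ i, ∑ j, ‖B i j - A i j‖ := by
  obtain ⟨x, hx, h⟩ := mem_realEigenvalues.1 hA.isLeast_lowestEigenvalue.1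
  have h1 := hB.lowestEigenvalue_mul_le x
  have h2 := star_dotProduct_mulVec_of_eigen h
  have h3 := (le_abs_self _).trans (abs_re_star_dotProduct_mulVec_le (B - A) x)
  rw [sub_mulVec, dotProduct_sub, Complex.sub_re, h2] at h3
  refine le_of_mul_le_mul_right ?_ (sum_norm_sq_pos hx)
  simp only [sub_apply] at h3
  linarith

theorem Matrix.continuous_lowestEigenvalue [Nonempty n] {X : Type*} [TopologicalSpace X]
    {A : X → Matrix n n ℂ} (hA : ∀ x, (A x).IsHermitian) (hc : Continuous A) :
    Continuous fun x => (A x).lowestEigenvalue := by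
  refine continuous_iff_continuousAt.2 fun a => ?_
  have hlim : Tendsto (fun x => ∑ i, ∑ j, ‖A x i j - A a i j‖) (𝓝 a) (𝓝 0) := by
    have : Continuous fun x => ∑ i, ∑ j, ‖A x i j - A a i j‖ := by fun_prop
    simpa using this.tendsto a
  refine tendsto_iff_dist_tendsto_zero.2 (squeeze_zero (fun _ => dist_nonneg) (fun x => ?_) hlim)
  rw [Real.dist_eq, abs_le']
  refine ⟨(hA a).lowestEigenvalue_sub_le (hA x), ?_⟩
  rw [neg_sub]
  refine ((hA x).lowestEigenvalue_sub_le (hA a)).trans_eq ?_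
  simp only [norm_sub_rev]

/-- A simple eigenvalue of a Hermitian matrix is a simple root of the characteristic polynomial. -/
theorem Matrix.IsHermitian.eval_derivative_charpoly_ne_zero {A : Matrix n n ℂ}
    (hA : A.IsHermitian) {t : ℝ} {φ : n → ℂ} (ht : t ∈ A.realEigenvalues)
    (hφ : ∀ x : n → ℂ, A *ᵥ x = (t : ℂ) • x → ∃ c : ℂ, x = c • φ) :
    A.charpoly.derivative.eval (t : ℂ) ≠ 0 := by
  -- Two distinct members of the eigenbasis belonging to `t` would be orthonormal multiples of the
  -- same `φ`.
  have huniq : ∀ i j, hA.eigenvalues i = t → hA.eigenvalues j = t → i = j := by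
    intro i j hi hj
    have hvec : ∀ k, hA.eigenvalues k = t → ∃ c : ℂ, (hA.eigenvectorBasis k : n → ℂ) = c • φ := by
      intro k hk
      refine hφ _ ?_
      rw [hA.mulVec_eigenvectorBasis, hk]
      rfl
    obtain ⟨a, ha⟩ := hvec i hi
    obtain ⟨b, hb⟩ := hvec j hj
    by_contra hij
    have hb0 : b ≠ 0 := by
      rintro rfl
      refine hA.eigenvectorBasis.orthonormal.ne_zero j ?_
      ext k
      simpa using congrFun hb k
    have h0 : inner ℂ (hA.eigenvectorBasis i) (hA.eigenvectorBasis j) = 0 :=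
      hA.eigenvectorBasis.orthonormal.2 hij
    have h1 : hA.eigenvectorBasis i = (a / b) • hA.eigenvectorBasis j := by
      ext k
      have h2 := congrFun ha k
      have h3 := congrFun hb k
      simp only [Pi.smul_apply, smul_eq_mul] at h2 h3
      rw [PiLp.smul_apply, h2, h3, smul_eq_mul]
      field_simp
    have h2 : a / b = 0 := by
      rw [h1, inner_smul_left, hA.eigenvectorBasis.inner_eq_one] at h0
      simpa using h0
    rw [h2, zero_smul] at h1
    exact hA.eigenvectorBasis.orthonormal.ne_zero i h1
  have hroot : A.charpoly.eval (t : ℂ) = 0 := by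
    obtain ⟨x, hx, h⟩ := mem_realEigenvalues.1 ht
    rw [eval_charpoly]
    refine exists_mulVec_eq_zero_iff.1 ⟨x, hx, ?_⟩
    rw [sub_mulVec, h, sub_eq_zero]
    ext i
    simp [scalar_apply]
  obtain ⟨i, hi⟩ : ∃ i, hA.eigenvalues i = t := by
    rw [hA.charpoly_eq, Polynomial.eval_prod, Finset.prod_eq_zero_iff] at hroot
    obtain ⟨i, -, hi⟩ := hroot
    refine ⟨i, ?_⟩
    rw [Polynomial.eval_sub, Polynomial.eval_X, Polynomial.eval_C, sub_eq_zero] at hi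
    exact Complex.ofReal_injective hi.symm
  -- Only the term differentiating the factor of the root `t` survives, leaving the product of `t`
  -- minus the other eigenvalues.
  rw [hA.charpoly_eq, ← Finset.mul_prod_erase _ _ (Finset.mem_univ i), Polynomial.derivative_mul]
  have h1 : Polynomial.eval (t : ℂ) (Polynomial.X - Polynomial.C ((hA.eigenvalues i : ℝ) : ℂ)) = 0 := by
    simp [hi]
  simp only [Polynomial.eval_add, Polynomial.eval_mul]
  rw [show ((hA.eigenvalues i : ℝ) : ℂ) = RCLike.ofReal (hA.eigenvalues i) from rfl] at h1
  rw [h1, zero_mul, add_zero, Polynomial.derivative_sub, Polynomial.derivative_X,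
    Polynomial.derivative_C, sub_zero, Polynomial.eval_one, one_mul, Polynomial.eval_prod]
  refine Finset.prod_ne_zero_iff.2 fun j hj => ?_
  rw [Polynomial.eval_sub, Polynomial.eval_X, Polynomial.eval_C, sub_ne_zero]
  intro h
  exact (Finset.mem_erase.1 hj).1 (huniq j i (Complex.ofReal_injective h.symm) hi)

open scoped ContDiff in
/-- A simple lowest eigenvalue of a smooth family of Hermitian matrices is smooth. -/
theorem Matrix.contDiffAt_lowestEigenvalue [Nonempty n] {E : Type*} [NormedAddCommGroup E]
    [NormedSpace ℝ E] [CompleteSpace E] {A : E → Matrix n n ℂ} {k : ℕ∞} (hk : k ≠ 0)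
    (hA : ∀ x, (A x).IsHermitian) (hs : ∀ i j, ContDiff ℝ k fun x => A x i j) {a : E} {φ : n → ℂ}
    (hφ : ∀ x : n → ℂ, A a *ᵥ x = ((A a).lowestEigenvalue : ℂ) • x → ∃ c : ℂ, x = c • φ) :
    ContDiffAt ℝ k (fun x => (A x).lowestEigenvalue) a := by
  set L : E → ℝ := fun x => (A x).lowestEigenvalue with hL
  have hLc : Continuous L := continuous_lowestEigenvalue hA
    (continuous_matrix fun i j => (hs i j).continuous)
  let F : E × ℂ → ℂ := fun p => (Matrix.scalar n p.2 - A p.1).det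
  have hF0 : ∀ x, F (x, (L x : ℂ)) = 0 := by
    intro x
    obtain ⟨y, hy, h⟩ := mem_realEigenvalues.1 (hA x).isLeast_lowestEigenvalue.1
    refine exists_mulVec_eq_zero_iff.1 ⟨y, hy, ?_⟩
    rw [sub_mulVec, h, sub_eq_zero]
    ext i
    simp [scalar_apply, hL]
  have hFs : ContDiff ℝ k F := by
    simp only [F, Matrix.det_apply]
    refine ContDiff.sum fun σ _ => ContDiff.const_smul _ (contDiff_prod fun i _ => ?_)
    simp only [sub_apply, scalar_apply, diagonal_apply]
    refine ContDiff.sub ?_ ((hs _ _).comp contDiff_fst)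
    split_ifs
    · exact contDiff_snd
    · exact contDiff_const
  have cdf : ContDiffAt ℝ k F (a, (L a : ℂ)) := hFs.contDiffAt
  have hk' : (k : ℕ∞ω) ≠ 0 := by exact_mod_cast hk
  have hd := (A a).charpoly.hasDerivAt (L a : ℂ)
  set D : ℂ := (A a).charpoly.derivative.eval (L a : ℂ) with hD
  have hD0 : D ≠ 0 :=
    (hA a).eval_derivative_charpoly_ne_zero (hA a).isLeast_lowestEigenvalue.1 hφ
  -- The partial derivative in the spectral variable is multiplication by `D ≠ 0`.
  have hinv : (fderiv ℝ F (a, (L a : ℂ)) ∘L .inr ℝ E ℂ).IsInvertible := by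
    have h1 : HasFDerivAt (fun z : ℂ => F (a, z))
        (fderiv ℝ F (a, (L a : ℂ)) ∘L .inr ℝ E ℂ) (L a : ℂ) :=
      ((cdf.differentiableAt hk').hasFDerivAt).comp (L a : ℂ) (hasFDerivAt_prodMk_right a _)
    have h2 : HasFDerivAt (fun z : ℂ => F (a, z))
        ((ContinuousLinearMap.toSpanSingleton ℂ D).restrictScalars ℝ) (L a : ℂ) := by
      have := hd.hasFDerivAt.restrictScalars ℝ
      simpa only [eval_charpoly] using this
    rw [h1.unique h2]
    refine ⟨(ContinuousLinearEquiv.unitsEquivAut ℂ (Units.mk0 D hD0)).restrictScalars ℝ, ?_⟩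
    ext; simp
  -- Near the base point the zero set of `F` is the graph of the implicit function. Continuity of
  -- `L` keeps `(x, L x)` in that neighbourhood, so the two functions agree there.
  have hev := cdf.eventually_apply_eq_iff_implicitFunction hk' hinv
  have htend : Tendsto (fun x => (x, (L x : ℂ))) (𝓝 a) (𝓝 (a, (L a : ℂ))) := by
    have : Continuous fun x => (x, (L x : ℂ)) := by fun_prop
    exact this.tendsto a
  have hC : ContDiffAt ℝ k (fun x => (cdf.implicitFunction hk' hinv x).re) a :=
    Complex.reCLM.contDiff.contDiffAt.comp a (cdf.contDiffAt_implicitFunction hk' hinv)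
  refine hC.congr_of_eventuallyEq ?_
  filter_upwards [htend.eventually hev] with x hx
  rw [hx.1 (by rw [hF0, hF0])]
  simp

/-- Inversion reverses the order of positive definite matrices. -/
theorem Matrix.PosDef.posSemidef_inv_sub_inv {A B : Matrix n n ℝ} (hA : A.PosDef)
    (hB : B.PosDef) (h : (B - A).PosSemidef) : (A⁻¹ - B⁻¹).PosSemidef := by
  have hAd := hA.det_pos.ne'.isUnit
  have hBd := hB.det_pos.ne'.isUnit
  have hBi : (B⁻¹)ᴴ = B⁻¹ := hB.inv.1
  -- The identity is `A⁻¹ - B⁻¹ = B⁻¹(B - A)B⁻¹ + B⁻¹(B - A)A⁻¹(B - A)B⁻¹`, a sum of two congruences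
  -- of positive semidefinite matrices.
  have h1 := h.conjTranspose_mul_mul_same B⁻¹
  have h2 := hA.inv.posSemidef.conjTranspose_mul_mul_same ((B - A) * B⁻¹)
  rw [conjTranspose_mul, hBi, h.1] at h2
  rw [hBi] at h1
  convert h1.add h2 using 1
  have e1 : B⁻¹ * (B - A) = 1 - B⁻¹ * A := by rw [mul_sub, nonsing_inv_mul _ hBd]
  have e2 : (B - A) * B⁻¹ = 1 - A * B⁻¹ := by rw [sub_mul, mul_nonsing_inv _ hBd]
  rw [e1, e2]
  simp only [sub_mul, mul_sub, one_mul, mul_one]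
  have e3 : B⁻¹ * A * A⁻¹ = B⁻¹ := by rw [mul_assoc, mul_nonsing_inv _ hAd, mul_one]
  have e4 : A⁻¹ * (A * B⁻¹) = B⁻¹ := by rw [← mul_assoc, nonsing_inv_mul _ hAd, one_mul]
  rw [e3, e4]
  abel_nf
  simp [mul_assoc]

end LinearAlgebra

/-! ### Second derivatives of functions that touch at a point. -/

section SecondDerivative

open Filter Topology

/-- A negative second derivative would make `a` a local maximum as well, so `h` would be locally
constant and its second derivative zero. -/
theorem deriv_deriv_nonneg_of_isLocalMin {h : ℝ → ℝ} {a : ℝ} (hmin : IsLocalMin h a)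
    (hc : ContinuousAt h a) : 0 ≤ deriv (deriv h) a := by
  by_contra! hneg
  have hmax := isLocalMax_of_deriv_deriv_neg hneg hmin.deriv_eq_zero hc
  have hconst : h =ᶠ[𝓝 a] fun _ => h a := by
    filter_upwards [hmin, hmax] with x h1 h2 using le_antisymm h2 h1
  have h2 := (hconst.deriv).deriv_eq
  simp only [deriv_const', deriv_const] at h2
  linarith

variable {E : Type*} [NormedAddCommGroup E] [NormedSpace ℝ E]

theorem eventually_deriv_line {f : E → ℝ} (hf : ContDiffAt ℝ 2 f 0) (x : E) :
    ∀ᶠ t in 𝓝 (0 : ℝ), HasDerivAt (fun s : ℝ => f (s • x)) (fderiv ℝ f (t • x) x) t := by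
  have h1 : ∀ᶠ y in 𝓝 (0 : E), ContDiffAt ℝ 2 f y := hf.eventually (by simp)
  have h2 : Tendsto (fun t : ℝ => t • x) (𝓝 0) (𝓝 0) := by
    have : Continuous fun t : ℝ => t • x := by fun_prop
    simpa using this.tendsto 0
  filter_upwards [h2.eventually h1] with t ht
  have h3 := (ht.differentiableAt (by simp)).hasFDerivAt
  have h4 : HasDerivAt (fun s : ℝ => s • x) x t := by
    simpa using (hasDerivAt_id t).smul_const x
  exact h3.comp_hasDerivAt t h4

theorem hasDerivAt_deriv_line {f : E → ℝ} (hf : ContDiffAt ℝ 2 f 0) (x : E) :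
    HasDerivAt (deriv fun s : ℝ => f (s • x)) (fderiv ℝ (fderiv ℝ f) 0 x x) 0 := by
  have h1 : ContDiffAt ℝ 1 (fderiv ℝ f) 0 := hf.fderiv_right (by norm_num)
  have h2 : HasFDerivAt (fderiv ℝ f) (fderiv ℝ (fderiv ℝ f) 0) ((0 : ℝ) • x) := by
    rw [zero_smul]
    exact (h1.differentiableAt (by simp)).hasFDerivAt
  have h4 : HasDerivAt (fun s : ℝ => s • x) x 0 := by
    simpa using (hasDerivAt_id (0 : ℝ)).smul_const x
  have h5 : HasDerivAt (fun t : ℝ => fderiv ℝ f (t • x) x) (fderiv ℝ (fderiv ℝ f) 0 x x) 0 := by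
    exact (ContinuousLinearMap.apply ℝ ℝ x).hasFDerivAt.comp_hasDerivAt (0 : ℝ)
      (h2.comp_hasDerivAt (0 : ℝ) h4)
  refine h5.congr_of_eventuallyEq ?_
  filter_upwards [eventually_deriv_line hf x] with t ht using ht.deriv

/-- A lower bound for a second derivative from a touching function. -/
theorem le_fderiv_fderiv_of_touching {f : E → ℝ} (hf : ContDiffAt ℝ 2 f 0) (x : E)
    {g g' : ℝ → ℝ} {c : ℝ} (hg : ∀ t, HasDerivAt g (g' t) t) (hg' : HasDerivAt g' c 0)
    (hle : ∀ t, g t - g 0 ≤ f (t • x) - f 0) : c ≤ fderiv ℝ (fderiv ℝ f) 0 x x := by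
  have h1 := eventually_deriv_line hf x
  have h2 : HasDerivAt (fun t : ℝ => f (t • x) - g t) (fderiv ℝ f ((0 : ℝ) • x) x - g' 0) 0 :=
    h1.self_of_nhds.sub (hg 0)
  have hmin : IsLocalMin (fun t : ℝ => f (t • x) - g t) 0 := by
    refine Filter.Eventually.of_forall fun t => ?_
    have := hle t
    simp only [zero_smul]
    linarith
  have h3 := deriv_deriv_nonneg_of_isLocalMin hmin h2.continuousAt
  have h4 : deriv (fun t : ℝ => f (t • x) - g t) =ᶠ[𝓝 0]
      fun t => deriv (fun s : ℝ => f (s • x)) t - g' t := by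
    filter_upwards [h1] with t ht
    rw [ht.deriv]
    exact (ht.sub (hg t)).deriv
  have h5 := (hasDerivAt_deriv_line hf x).sub hg'
  have h6 : deriv (deriv fun t : ℝ => f (t • x) - g t) 0 = fderiv ℝ (fderiv ℝ f) 0 x x - c := by
    rw [h4.deriv_eq]
    exact h5.deriv
  linarith

/-- On every line through `0` the function `C f - g` is minimal at `0`. -/
theorem fderiv_fderiv_le_of_le {f g : E → ℝ} (hf : ContDiffAt ℝ 2 f 0) (hg : ContDiffAt ℝ 2 g 0)
    {C : ℝ} (hle : ∀ y, g y - g 0 ≤ C * (f y - f 0)) (x : E) :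
    fderiv ℝ (fderiv ℝ g) 0 x x ≤ C * fderiv ℝ (fderiv ℝ f) 0 x x := by
  have h1 := eventually_deriv_line hf x
  have h2 := eventually_deriv_line hg x
  have hd := (h1.self_of_nhds.const_mul C).sub h2.self_of_nhds
  have hmin : IsLocalMin (fun t : ℝ => C * f (t • x) - g (t • x)) 0 := by
    refine Filter.Eventually.of_forall fun t => ?_
    have := hle (t • x)
    simp only [zero_smul]
    linarith
  have h3 := deriv_deriv_nonneg_of_isLocalMin hmin hd.continuousAt
  have h4 : deriv (fun t : ℝ => C * f (t • x) - g (t • x)) =ᶠ[𝓝 0]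
      fun t => C * deriv (fun s : ℝ => f (s • x)) t - deriv (fun s : ℝ => g (s • x)) t := by
    filter_upwards [h1, h2] with t ht ht'
    rw [ht.deriv, ht'.deriv]
    exact ((ht.const_mul C).sub ht').deriv
  have h5 := ((hasDerivAt_deriv_line hf x).const_mul C).sub (hasDerivAt_deriv_line hg x)
  have h6 := h4.deriv_eq.trans h5.deriv
  linarith

end SecondDerivative

namespace PeriodicGraph

open Matrix

variable {d : ℕ} {V A : Type*} [AddAction (Fin d → ℤ) V] [AddAction (Fin d → ℤ) A]
  {G : PeriodicGraph d V A}

noncomputable instance : DecidableEq G.QVertex := Classical.decEq _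

/-! ### The fundamental graph -/

/-- The opposite of an oriented edge of the fundamental graph. -/
def qrev (G : PeriodicGraph d V A) : G.QEdge → G.QEdge :=
  G.descendE (fun e => G.mkE (G.rev e)) (fun m e => G.mkE_eq.2 ⟨m, (G.rev_vadd m e).symm⟩)

theorem exists_mkV (x : G.QVertex) : ∃ v, G.mkV v = x := Quotient.exists_rep x

theorem exists_mkE (x : G.QEdge) : ∃ e, G.mkE e = x := Quotient.exists_rep x

theorem qsrc_mkE (e : A) : G.qsrc (G.mkE e) = G.mkV (G.src e) := rfl

theorem qtgt_mkE (e : A) : G.qtgt (G.mkE e) = G.mkV (G.tgt e) := rfl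

theorem qrev_mkE (e : A) : G.qrev (G.mkE e) = G.mkE (G.rev e) := rfl

theorem qdegree_mkV (v : V) : G.qdegree (G.mkV v) = G.degree v := rfl

theorem tgt_rev (e : A) : G.tgt (G.rev e) = G.src e := by
  rw [← G.src_rev, G.rev_rev]

theorem qrev_qrev (e : G.QEdge) : G.qrev (G.qrev e) = e := by
  obtain ⟨e, rfl⟩ := exists_mkE e
  rw [qrev_mkE, qrev_mkE, G.rev_rev]

theorem qsrc_qrev (e : G.QEdge) : G.qsrc (G.qrev e) = G.qtgt e := by
  obtain ⟨e, rfl⟩ := exists_mkE e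
  rw [qrev_mkE, qsrc_mkE, qtgt_mkE, G.src_rev]

theorem qtgt_qrev (e : G.QEdge) : G.qtgt (G.qrev e) = G.qsrc e := by
  rw [← qsrc_qrev, qrev_qrev]

theorem FundamentalSet.qindex_mkE (S : G.FundamentalSet) (e : A) :
    S.qindex (G.mkE e) = S.coord (G.tgt e) - S.coord (G.src e) := rfl

theorem FundamentalSet.qindex_qrev (S : G.FundamentalSet) (e : G.QEdge) :
    S.qindex (G.qrev e) = -S.qindex e := by
  obtain ⟨e, rfl⟩ := exists_mkE e
  rw [qrev_mkE, S.qindex_mkE, S.qindex_mkE, G.src_rev, tgt_rev, neg_sub]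

theorem sum_qrev {M : Type*} [AddCommMonoid M] (F : G.QEdge → M) :
    ∑ e, F (G.qrev e) = ∑ e, F e :=
  Equiv.sum_comp (Function.Involutive.toPerm G.qrev qrev_qrev) F

/-- Connectedness of the fundamental graph, as an induction principle: a path in the periodic graph
projects to it. -/
theorem reach_induction {p : G.QVertex → Prop} (h : ∀ e, p (G.qsrc e) → p (G.qtgt e))
    {x y : G.QVertex} (hx : p x) : p y := by
  obtain ⟨u, rfl⟩ := exists_mkV x
  obtain ⟨v, rfl⟩ := exists_mkV y
  induction G.connected u v with
  | refl => exact hx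
  | tail _ hbc ih =>
    obtain ⟨e, rfl, rfl⟩ := hbc
    exact h (G.mkE e) ih

/-- The action is free and `d > 0`, so `v` has a translate other than itself, and a path to it
leaves `v` through an edge. -/
theorem degree_pos (hd : 0 < d) (v : V) : 0 < G.degree v := by
  have hne : (Pi.single ⟨0, hd⟩ 1 : Fin d → ℤ) +ᵥ v ≠ v := by
    intro h
    have := congrFun (G.free _ v h) ⟨0, hd⟩
    simp at this
  rcases (G.connected v _).cases_head with h | ⟨w, ⟨e, he, -⟩, -⟩
  · exact absurd h.symm hne
  · exact Finset.card_pos.2 ⟨e, G.mem_star.2 he⟩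

theorem qdegree_pos (hd : 0 < d) (x : G.QVertex) : 0 < G.qdegree x := by
  obtain ⟨v, rfl⟩ := exists_mkV x
  exact degree_pos hd v

/-! ### Phases of edges -/

theorem pairing_zero (k : Fin d → ℤ) : pairing k 0 = 0 := by simp [pairing]

theorem pairing_neg (k : Fin d → ℤ) (θ : Fin d → ℝ) : pairing (-k) θ = -pairing k θ := by
  simp [pairing]

theorem pairing_add (k l : Fin d → ℤ) (θ : Fin d → ℝ) :
    pairing (k + l) θ = pairing k θ + pairing l θ := by
  simp [pairing, add_mul, Finset.sum_add_distrib]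

theorem pairing_sub (k l : Fin d → ℤ) (θ : Fin d → ℝ) :
    pairing (k - l) θ = pairing k θ - pairing l θ := by
  rw [sub_eq_add_neg, pairing_add, pairing_neg, sub_eq_add_neg]

namespace FundamentalSet

variable (S : G.FundamentalSet)

/-- The factor `e^{i⟨τ(e), θ⟩}` of an oriented edge of the fundamental graph. -/
noncomputable def phase (θ : Fin d → ℝ) (e : G.QEdge) : ℂ :=
  Complex.exp (Complex.I * (pairing (S.qindex e) θ : ℂ))

theorem phase_zero (e : G.QEdge) : S.phase 0 e = 1 := by
  simp [phase, pairing_zero]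

theorem norm_exp_I_mul (t : ℝ) : ‖Complex.exp (Complex.I * (t : ℂ))‖ = 1 := by
  rw [mul_comm, Complex.norm_exp_ofReal_mul_I]

theorem norm_phase (θ : Fin d → ℝ) (e : G.QEdge) : ‖S.phase θ e‖ = 1 := norm_exp_I_mul _

theorem phase_qrev (θ : Fin d → ℝ) (e : G.QEdge) :
    S.phase θ (G.qrev e) = Star.star (S.phase θ e) := by
  rw [phase, phase, S.qindex_qrev, pairing_neg, RCLike.star_def, ← Complex.exp_conj]
  simp

/-- The weight `1 / √(κ_u κ_v)` of an oriented edge `(u, v)` of the fundamental graph. -/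
noncomputable def _root_.PeriodicGraph.weight (G : PeriodicGraph d V A) (e : G.QEdge) : ℝ :=
  (Real.sqrt ((G.qdegree (G.qsrc e) : ℝ) * (G.qdegree (G.qtgt e) : ℝ)))⁻¹

theorem _root_.PeriodicGraph.weight_nonneg (e : G.QEdge) : 0 ≤ G.weight e := by
  unfold weight; positivity

theorem _root_.PeriodicGraph.weight_pos (hd : 0 < d) (e : G.QEdge) : 0 < G.weight e := by
  have h1 := qdegree_pos hd (G.qsrc e)
  have h2 := qdegree_pos hd (G.qtgt e)
  unfold weight
  positivity

theorem _root_.PeriodicGraph.weight_qrev (e : G.QEdge) : G.weight (G.qrev e) = G.weight e := by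
  rw [weight, weight, qsrc_qrev, qtgt_qrev, mul_comm]

theorem fiber_apply (Q : G.Potential) (θ : Fin d → ℝ) (f : G.QVertex → ℂ) (v : G.QVertex) :
    S.fiber Q θ f v = ((1 + Q.onQuotient v : ℝ) : ℂ) * f v -
      ∑ e : G.QEdge with G.qsrc e = v, S.phase θ e * (G.weight e : ℂ) * f (G.qtgt e) := by
  have : S.fiber Q θ f v = (f v - ∑ e : G.QEdge with G.qsrc e = v,
      Complex.exp (Complex.I * (pairing (S.qindex e) θ : ℂ)) /
        (Real.sqrt ((G.qdegree v : ℝ) * (G.qdegree (G.qtgt e) : ℝ)) : ℂ) * f (G.qtgt e)) +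
      (Q.onQuotient v : ℂ) * f v := by
    simp only [fiber, fiberLaplacian, LinearMap.add_apply, Pi.add_apply, LinearMap.coe_mk,
      AddHom.coe_mk, LinearMap.pi_apply, LinearMap.smul_apply, LinearMap.proj_apply, smul_eq_mul]
  have h2 : ∑ e : G.QEdge with G.qsrc e = v,
      Complex.exp (Complex.I * (pairing (S.qindex e) θ : ℂ)) /
        (Real.sqrt ((G.qdegree v : ℝ) * (G.qdegree (G.qtgt e) : ℝ)) : ℂ) * f (G.qtgt e) =
      ∑ e : G.QEdge with G.qsrc e = v, S.phase θ e * (G.weight e : ℂ) * f (G.qtgt e) := by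
    refine Finset.sum_congr rfl fun e he => ?_
    rw [Finset.mem_filter] at he
    rw [phase, weight, he.2, Complex.ofReal_inv, div_eq_mul_inv]
  rw [this, h2]
  push_cast
  ring

/-- The matrix of the fiber operator `H(θ)`. -/
noncomputable def fiberMatrix (Q : G.Potential) (θ : Fin d → ℝ) : Matrix G.QVertex G.QVertex ℂ :=
  LinearMap.toMatrix' (S.fiber Q θ)

theorem fiberMatrix_mulVec (Q : G.Potential) (θ : Fin d → ℝ) (f : G.QVertex → ℂ) :
    S.fiberMatrix Q θ *ᵥ f = S.fiber Q θ f := by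
  rw [fiberMatrix, LinearMap.toMatrix'_mulVec]

theorem realEigenvalues_fiberMatrix (Q : G.Potential) (θ : Fin d → ℝ) :
    (S.fiberMatrix Q θ).realEigenvalues = S.eigenvalues Q θ := by
  rw [Matrix.realEigenvalues, fiberMatrix, Matrix.toLin'_toMatrix']
  rfl

theorem lowestEigenvalue_fiberMatrix (Q : G.Potential) (θ : Fin d → ℝ) :
    (S.fiberMatrix Q θ).lowestEigenvalue = S.lowest Q θ := by
  rw [Matrix.lowestEigenvalue, realEigenvalues_fiberMatrix]
  rfl

theorem fiberMatrix_apply (Q : G.Potential) (θ : Fin d → ℝ) (v u : G.QVertex) :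
    S.fiberMatrix Q θ v u = (if v = u then ((1 + Q.onQuotient v : ℝ) : ℂ) else 0) -
      ∑ e : G.QEdge, if G.qsrc e = v ∧ G.qtgt e = u then S.phase θ e * (G.weight e : ℂ) else 0 := by
  rw [fiberMatrix, LinearMap.toMatrix'_apply, fiber_apply, Finset.sum_filter]
  congr 1
  · simp [Pi.single_apply]
  · refine Finset.sum_congr rfl fun e _ => ?_
    by_cases h1 : G.qsrc e = v <;> by_cases h2 : G.qtgt e = u <;> simp [h1, h2]

/-- Reversing an edge swaps its endpoints, keeps its weight and conjugates its phase. -/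
theorem fiberMatrix_isHermitian (Q : G.Potential) (θ : Fin d → ℝ) :
    (S.fiberMatrix Q θ).IsHermitian := by
  ext v u
  rw [conjTranspose_apply, fiberMatrix_apply, fiberMatrix_apply, star_sub, star_sum]
  congr 1
  · by_cases h : v = u
    · subst h
      simp
    · rw [if_neg h, if_neg (Ne.symm h), star_zero]
  · rw [← sum_qrev]
    refine Finset.sum_congr rfl fun e _ => ?_
    rw [qsrc_qrev, qtgt_qrev, phase_qrev, weight_qrev]
    by_cases h1 : G.qsrc e = v <;> by_cases h2 : G.qtgt e = u <;> simp [h1, h2]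

theorem form_fiberMatrix (Q : G.Potential) (θ : Fin d → ℝ) (f : G.QVertex → ℂ) :
    (Star.star f ⬝ᵥ S.fiberMatrix Q θ *ᵥ f).re = ∑ v, (1 + Q.onQuotient v) * ‖f v‖ ^ 2 -
      ∑ e : G.QEdge, G.weight e * (Star.star (f (G.qsrc e)) * (S.phase θ e * f (G.qtgt e))).re := by
  rw [fiberMatrix_mulVec, dotProduct]
  simp only [fiber_apply, Pi.star_apply, mul_sub, Finset.sum_sub_distrib, Complex.sub_re,
    Complex.re_sum]
  congr 1
  · refine Finset.sum_congr rfl fun v _ => ?_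
    rw [mul_left_comm, RCLike.star_def, Complex.conj_mul', ← Complex.ofReal_pow,
      ← Complex.ofReal_mul, Complex.ofReal_re]
  · rw [← Finset.sum_fiberwise Finset.univ G.qsrc]
    refine Finset.sum_congr rfl fun v _ => ?_
    rw [Finset.mul_sum, Complex.re_sum]
    refine Finset.sum_congr rfl fun e he => ?_
    rw [Finset.mem_filter] at he
    rw [he.2, ← Complex.re_ofReal_mul]
    congr 1
    ring

theorem eigen_real_iff (Q : G.Potential) (ψ : G.QVertex → ℝ) (μ : ℝ) :
    S.fiber Q 0 (fun v => (ψ v : ℂ)) = (μ : ℂ) • (fun v => (ψ v : ℂ)) ↔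
      ∀ v, (1 + Q.onQuotient v - μ) * ψ v =
        ∑ e : G.QEdge with G.qsrc e = v, G.weight e * ψ (G.qtgt e) := by
  rw [funext_iff]
  refine forall_congr' fun v => ?_
  rw [fiber_apply]
  simp only [phase_zero, one_mul, Pi.smul_apply, smul_eq_mul]
  norm_cast
  constructor <;> intro h <;> linarith

/-! ### The energy form of a positive solution -/

/-- The energy `∑_e w_e |g(u) - e^{i⟨τ(e), θ⟩} g(v)|²` over the edges `e = (u, v)`. -/
noncomputable def energy (w : G.QEdge → ℝ) (θ : Fin d → ℝ) (g : G.QVertex → ℂ) : ℝ :=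
  ∑ e, w e * ‖g (G.qsrc e) - S.phase θ e * g (G.qtgt e)‖ ^ 2

theorem energy_nonneg {w : G.QEdge → ℝ} (hw : ∀ e, 0 ≤ w e) (θ : Fin d → ℝ)
    (g : G.QVertex → ℂ) : 0 ≤ S.energy w θ g :=
  Finset.sum_nonneg fun e _ => mul_nonneg (hw e) (sq_nonneg _)

/-- The edge weights of the ground state representation. -/
noncomputable def _root_.PeriodicGraph.psiWeight (G : PeriodicGraph d V A) (ψ : G.QVertex → ℝ)
    (e : G.QEdge) : ℝ :=
  G.weight e * (ψ (G.qsrc e) * ψ (G.qtgt e))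

/-- The ground state representation of the quadratic form of `H(θ)`. -/
theorem form_eq_energy {Q : G.Potential} {ψ : G.QVertex → ℝ} {μ : ℝ}
    (h : S.fiber Q 0 (fun v => (ψ v : ℂ)) = (μ : ℂ) • (fun v => (ψ v : ℂ)))
    (θ : Fin d → ℝ) (g : G.QVertex → ℂ) :
    (Star.star (fun v => (ψ v : ℂ) * g v) ⬝ᵥ S.fiberMatrix Q θ *ᵥ (fun v => (ψ v : ℂ) * g v)).re -
      μ * ∑ v, ‖(ψ v : ℂ) * g v‖ ^ 2 = S.energy (G.psiWeight ψ) θ g / 2 := by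
  rw [eigen_real_iff] at h
  -- The eigenvalue equation for `ψ` replaces the diagonal part, potential included, by a sum over
  -- edges.
  have hdiag : ∑ v, (1 + Q.onQuotient v) * ‖(ψ v : ℂ) * g v‖ ^ 2 -
      μ * ∑ v, ‖(ψ v : ℂ) * g v‖ ^ 2 = ∑ e, G.psiWeight ψ e * ‖g (G.qsrc e)‖ ^ 2 := by
    rw [Finset.mul_sum, ← Finset.sum_sub_distrib, ← Finset.sum_fiberwise Finset.univ G.qsrc]
    refine Finset.sum_congr rfl fun v _ => ?_
    have h1 : (1 + Q.onQuotient v) * ‖(ψ v : ℂ) * g v‖ ^ 2 - μ * ‖(ψ v : ℂ) * g v‖ ^ 2 =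
        ((1 + Q.onQuotient v - μ) * ψ v) * (ψ v * ‖g v‖ ^ 2) := by
      rw [norm_mul, mul_pow, Complex.norm_real, Real.norm_eq_abs, sq_abs]
      ring
    rw [h1, h v, Finset.sum_mul]
    refine Finset.sum_congr rfl fun e he => ?_
    rw [Finset.mem_filter] at he
    rw [psiWeight, he.2]
    ring
  -- Edge reversal splits the diagonal part evenly between the endpoints, which produces the two
  -- squares of the energy and the factor `1/2`.
  have hsymm : ∑ e, G.psiWeight ψ e * ‖g (G.qsrc e)‖ ^ 2 =
      ∑ e, G.psiWeight ψ e * ‖g (G.qtgt e)‖ ^ 2 := by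
    rw [← sum_qrev]
    refine Finset.sum_congr rfl fun e _ => ?_
    rw [psiWeight, psiWeight, weight_qrev, qsrc_qrev, qtgt_qrev, mul_comm (ψ (G.qtgt e))]
  have hexp : S.energy (G.psiWeight ψ) θ g = ∑ e, G.psiWeight ψ e * ‖g (G.qsrc e)‖ ^ 2 +
      ∑ e, G.psiWeight ψ e * ‖g (G.qtgt e)‖ ^ 2 -
      2 * ∑ e : G.QEdge, G.weight e * (Star.star ((ψ (G.qsrc e) : ℂ) * g (G.qsrc e)) *
        (S.phase θ e * ((ψ (G.qtgt e) : ℂ) * g (G.qtgt e)))).re := by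
    rw [energy, Finset.mul_sum, ← Finset.sum_add_distrib, ← Finset.sum_sub_distrib]
    refine Finset.sum_congr rfl fun e _ => ?_
    have h1 := norm_sub_sq (𝕜 := ℂ) (g (G.qsrc e)) (S.phase θ e * g (G.qtgt e))
    rw [norm_mul, norm_phase, one_mul, RCLike.inner_apply, RCLike.re_eq_complex_re] at h1
    have h2 : Star.star ((ψ (G.qsrc e) : ℂ) * g (G.qsrc e)) *
        (S.phase θ e * ((ψ (G.qtgt e) : ℂ) * g (G.qtgt e))) =
        ((ψ (G.qsrc e) * ψ (G.qtgt e) : ℝ) : ℂ) *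
          (S.phase θ e * g (G.qtgt e) * (starRingEnd ℂ) (g (G.qsrc e))) := by
      rw [star_mul', RCLike.star_def, Complex.conj_ofReal]
      push_cast
      ring
    rw [h1, h2, Complex.re_ofReal_mul, psiWeight]
    ring
  rw [form_fiberMatrix]
  linarith

/-! ### Ground states: variational characterization, comparison, existence and simplicity. -/

theorem isLeast_lowest (Q : G.Potential) (θ : Fin d → ℝ) :
    IsLeast (S.eigenvalues Q θ) (S.lowest Q θ) := by
  rw [← lowestEigenvalue_fiberMatrix, ← realEigenvalues_fiberMatrix]
  exact (S.fiberMatrix_isHermitian Q θ).isLeast_lowestEigenvalue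

theorem exists_lowest_eigenvector (Q : G.Potential) (θ : Fin d → ℝ) :
    ∃ f : G.QVertex → ℂ, f ≠ 0 ∧ S.fiberMatrix Q θ *ᵥ f = (S.lowest Q θ : ℂ) • f := by
  have h := (S.isLeast_lowest Q θ).1
  rw [← realEigenvalues_fiberMatrix] at h
  exact Matrix.mem_realEigenvalues.1 h

theorem psiWeight_nonneg {ψ : G.QVertex → ℝ} (h : ∀ v, 0 < ψ v) (e : G.QEdge) :
    0 ≤ G.psiWeight ψ e :=
  mul_nonneg (weight_nonneg e) (mul_pos (h _) (h _)).le

theorem ofReal_mul_div_cancel {ψ : G.QVertex → ℝ} (h : ∀ v, 0 < ψ v) (f : G.QVertex → ℂ) :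
    (fun v => (ψ v : ℂ) * (f v / (ψ v : ℂ))) = f := by
  funext v
  have : (ψ v : ℂ) ≠ 0 := by exact_mod_cast (h v).ne'
  field_simp

/-- A positive eigenvector of `H(0)` belongs to the lowest eigenvalue. -/
theorem isPositiveGroundState_of_eigen {Q : G.Potential} {ψ : G.QVertex → ℝ} {μ : ℝ}
    (hpos : ∀ v, 0 < ψ v)
    (h : S.fiber Q 0 (fun v => (ψ v : ℂ)) = (μ : ℂ) • (fun v => (ψ v : ℂ))) :
    S.lowest Q 0 = μ ∧ S.IsPositiveGroundState Q ψ := by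
  have hne : (fun v => (ψ v : ℂ)) ≠ 0 := by
    intro h0
    have := congrFun h0 (Classical.arbitrary G.QVertex)
    exact (hpos _).ne' (Complex.ofReal_eq_zero.1 this)
  have hev : ∀ {t : ℝ}, S.fiber Q 0 (fun v => (ψ v : ℂ)) = (t : ℂ) • (fun v => (ψ v : ℂ)) →
      (S.fiber Q 0).HasEigenvector (t : ℂ) (fun v => (ψ v : ℂ)) := fun ht =>
    Module.End.hasEigenvector_iff.2 ⟨Module.End.mem_eigenspace_iff.2 ht, hne⟩
  have hle : S.lowest Q 0 ≤ μ := (S.isLeast_lowest Q 0).2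
    (Module.End.hasEigenvalue_of_hasEigenvector (hev h))
  -- Divide a lowest eigenvector by `ψ`: its energy is nonnegative, and equals `S.lowest Q 0 - μ`
  -- times a positive factor.
  have hge : μ ≤ S.lowest Q 0 := by
    obtain ⟨f, hf, hfe⟩ := S.exists_lowest_eigenvector Q 0
    have h1 := S.form_eq_energy h 0 (fun v => f v / (ψ v : ℂ))
    have h2 := S.energy_nonneg (psiWeight_nonneg hpos) 0 (fun v => f v / (ψ v : ℂ))
    have h3 := congrFun (ofReal_mul_div_cancel hpos f)
    simp only [h3] at h1
    have h4 := Matrix.star_dotProduct_mulVec_of_eigen hfe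
    refine le_of_mul_le_mul_right ?_ (sum_norm_sq_pos hf)
    have h5 : (Star.star (fun v => f v) ⬝ᵥ S.fiberMatrix Q 0 *ᵥ fun v => f v).re =
        S.lowest Q 0 * ∑ v, ‖f v‖ ^ 2 := h4
    linarith
  have heq := le_antisymm hle hge
  exact ⟨heq, hpos, by rw [heq]; exact hev h⟩

variable {S}

theorem IsPositiveGroundState.fiber_eq {Q : G.Potential} {ψ : G.QVertex → ℝ}
    (h : S.IsPositiveGroundState Q ψ) :
    S.fiber Q 0 (fun v => (ψ v : ℂ)) = (S.lowest Q 0 : ℂ) • (fun v => (ψ v : ℂ)) :=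
  h.2.apply_eq_smul

theorem sum_norm_ofReal_mul (ψ : G.QVertex → ℝ) (g : G.QVertex → ℂ) :
    ∑ v, ‖(ψ v : ℂ) * g v‖ ^ 2 = ∑ v, ψ v ^ 2 * ‖g v‖ ^ 2 := by
  refine Finset.sum_congr rfl fun v _ => ?_
  rw [norm_mul, mul_pow, Complex.norm_real, Real.norm_eq_abs, sq_abs]

theorem IsPositiveGroundState.le_energy {Q : G.Potential} {ψ : G.QVertex → ℝ}
    (h : S.IsPositiveGroundState Q ψ) (θ : Fin d → ℝ) (g : G.QVertex → ℂ) :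
    (S.lowest Q θ - S.lowest Q 0) * ∑ v, ψ v ^ 2 * ‖g v‖ ^ 2 ≤
      S.energy (G.psiWeight ψ) θ g / 2 := by
  have h1 := S.form_eq_energy h.fiber_eq θ g
  have h2 := (S.fiberMatrix_isHermitian Q θ).lowestEigenvalue_mul_le (fun v => (ψ v : ℂ) * g v)
  rw [lowestEigenvalue_fiberMatrix] at h2
  rw [← sum_norm_ofReal_mul]
  linarith

/-- The minimizer is `f / ψ`, with `f` a lowest eigenvector of `H(θ)`. -/
theorem IsPositiveGroundState.exists_energy_eq {Q : G.Potential} {ψ : G.QVertex → ℝ}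
    (h : S.IsPositiveGroundState Q ψ) (θ : Fin d → ℝ) :
    ∃ g : G.QVertex → ℂ, g ≠ 0 ∧ (S.lowest Q θ - S.lowest Q 0) * ∑ v, ψ v ^ 2 * ‖g v‖ ^ 2 =
      S.energy (G.psiWeight ψ) θ g / 2 := by
  obtain ⟨f, hf, hfe⟩ := S.exists_lowest_eigenvector Q θ
  have hc := ofReal_mul_div_cancel h.1 f
  refine ⟨fun v => f v / (ψ v : ℂ), ?_, ?_⟩
  · intro h0
    apply hf
    rw [← hc]
    funext v
    have := congrFun h0 v
    simp only [Pi.zero_apply] at this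
    rw [this, mul_zero, Pi.zero_apply]
  · have h1 := S.form_eq_energy h.fiber_eq θ (fun v => f v / (ψ v : ℂ))
    rw [← sum_norm_ofReal_mul, ← h1, hc, Matrix.star_dotProduct_mulVec_of_eigen hfe]
    simp only [congrFun hc]
    ring

theorem sum_sq_mul_norm_pos {ψ : G.QVertex → ℝ} (h : ∀ v, 0 < ψ v) {g : G.QVertex → ℂ}
    (hg : g ≠ 0) : 0 < ∑ v, ψ v ^ 2 * ‖g v‖ ^ 2 := by
  obtain ⟨v, hv⟩ := Function.ne_iff.1 hg
  exact Finset.sum_pos' (fun _ _ => by positivity) ⟨v, Finset.mem_univ _, by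
    have h1 : 0 < ‖g v‖ := norm_pos_iff.2 hv
    have h2 := h v
    positivity⟩

theorem IsPositiveGroundState.lowest_zero_le {Q : G.Potential} {ψ : G.QVertex → ℝ}
    (h : S.IsPositiveGroundState Q ψ) (θ : Fin d → ℝ) : S.lowest Q 0 ≤ S.lowest Q θ := by
  obtain ⟨g, hg, he⟩ := h.exists_energy_eq θ
  have h1 := S.energy_nonneg (psiWeight_nonneg h.1) θ g
  have h2 := sum_sq_mul_norm_pos h.1 hg
  have h3 : 0 ≤ S.lowest Q θ - S.lowest Q 0 := by
    by_contra! hneg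
    nlinarith
  linarith

/-- Comparison of the first bands of two potentials with comparable ground states. -/
theorem IsPositiveGroundState.lowest_sub_le {P Q : G.Potential} {φ ψ : G.QVertex → ℝ}
    (hφ : S.IsPositiveGroundState P φ) (hψ : S.IsPositiveGroundState Q ψ) {a b : ℝ} (ha : 0 < a)
    (hal : ∀ v, a * φ v ≤ ψ v) (hbu : ∀ v, ψ v ≤ b * φ v) (θ : Fin d → ℝ) :
    S.lowest Q θ - S.lowest Q 0 ≤ (b / a) ^ 2 * (S.lowest P θ - S.lowest P 0) := by
  -- The quotient `g`, not the eigenvector `φ g`, is carried over: the trial vector for `Q` is `ψ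
  -- g`. The energy then grows by at most `b²`, and the norm shrinks by at most `a²`.
  obtain ⟨g, hg, he⟩ := hφ.exists_energy_eq θ
  have h1 := hψ.le_energy θ g
  have h2 : S.energy (G.psiWeight ψ) θ g ≤ b ^ 2 * S.energy (G.psiWeight φ) θ g := by
    rw [energy, energy, Finset.mul_sum]
    refine Finset.sum_le_sum fun e _ => ?_
    rw [← mul_assoc]
    refine mul_le_mul_of_nonneg_right ?_ (sq_nonneg _)
    have h3 := mul_le_mul (hbu (G.qsrc e)) (hbu (G.qtgt e)) (hψ.1 _).le
      ((hψ.1 _).le.trans (hbu (G.qsrc e)))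
    have h4 := mul_le_mul_of_nonneg_left h3 (weight_nonneg e)
    rw [psiWeight, psiWeight]
    linarith
  have h3 : ∑ v, φ v ^ 2 * ‖g v‖ ^ 2 ≤ (a ^ 2)⁻¹ * ∑ v, ψ v ^ 2 * ‖g v‖ ^ 2 := by
    rw [Finset.mul_sum]
    refine Finset.sum_le_sum fun v _ => ?_
    rw [← mul_assoc]
    refine mul_le_mul_of_nonneg_right ?_ (sq_nonneg _)
    rw [inv_mul_eq_div, le_div_iff₀ (by positivity)]
    have := pow_le_pow_left₀ (mul_pos ha (hφ.1 v)).le (hal v) 2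
    linarith
  have hD := sub_nonneg.2 (hφ.lowest_zero_le θ)
  refine le_of_mul_le_mul_right ?_ (sum_sq_mul_norm_pos hψ.1 hg)
  calc _ ≤ S.energy (G.psiWeight ψ) θ g / 2 := h1
    _ ≤ b ^ 2 * (S.energy (G.psiWeight φ) θ g / 2) := by linarith
    _ = b ^ 2 * ((S.lowest P θ - S.lowest P 0) * ∑ v, φ v ^ 2 * ‖g v‖ ^ 2) := by rw [he]
    _ ≤ b ^ 2 * ((S.lowest P θ - S.lowest P 0) * ((a ^ 2)⁻¹ * ∑ v, ψ v ^ 2 * ‖g v‖ ^ 2)) := by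
      gcongr
    _ = _ := by rw [div_pow]; ring

/-- The lowest eigenvalue of `H(0)` is simple. -/
theorem IsPositiveGroundState.eq_smul (hd : 0 < d) {Q : G.Potential} {ψ : G.QVertex → ℝ}
    (h : S.IsPositiveGroundState Q ψ) {f : G.QVertex → ℂ}
    (hf : S.fiberMatrix Q 0 *ᵥ f = (S.lowest Q 0 : ℂ) • f) :
    ∃ c : ℂ, f = c • (fun v => (ψ v : ℂ)) := by
  have hc := ofReal_mul_div_cancel h.1 f
  have h1 := S.form_eq_energy h.fiber_eq 0 (fun v => f v / (ψ v : ℂ))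
  rw [hc, Matrix.star_dotProduct_mulVec_of_eigen hf] at h1
  simp only [congrFun hc, sub_self] at h1
  -- Zero energy with positive weights and trivial phases makes `f / ψ` constant across each edge,
  -- hence everywhere.
  have h2 : S.energy (G.psiWeight ψ) 0 (fun v => f v / (ψ v : ℂ)) = 0 := by linarith
  rw [energy, Finset.sum_eq_zero_iff_of_nonneg
    (fun e _ => mul_nonneg (psiWeight_nonneg h.1 e) (sq_nonneg _))] at h2
  let v₀ := Classical.arbitrary G.QVertex
  refine ⟨f v₀ / (ψ v₀ : ℂ), ?_⟩
  have h3 : ∀ v, f v / (ψ v : ℂ) = f v₀ / (ψ v₀ : ℂ) := fun v => by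
    refine reach_induction (p := fun v => f v / (ψ v : ℂ) = f v₀ / (ψ v₀ : ℂ)) (x := v₀)
      (fun e he => ?_) rfl
    have h4 := h2 e (Finset.mem_univ e)
    have h5 : G.psiWeight ψ e ≠ 0 :=
      (mul_pos (weight_pos hd e) (mul_pos (h.1 _) (h.1 _))).ne'
    rw [mul_eq_zero, or_iff_right h5, sq_eq_zero_iff, norm_eq_zero, phase_zero, one_mul,
      sub_eq_zero] at h4
    rw [← h4, he]
  funext v
  rw [Pi.smul_apply, smul_eq_mul, ← h3 v, div_mul_cancel₀]
  exact_mod_cast (h.1 v).ne'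

/-- The Perron-Frobenius theorem for `H(0)`. -/
theorem exists_isPositiveGroundState (hd : 0 < d) (S : G.FundamentalSet) (Q : G.Potential) :
    ∃ ψ, S.IsPositiveGroundState Q ψ := by
  obtain ⟨f, hf, hfe⟩ := S.exists_lowest_eigenvector Q 0
  set ψ : G.QVertex → ℝ := fun v => ‖f v‖ with hψ
  -- At `θ = 0` the off-diagonal contributions are nonpositive multiples of `Re (conj f(u) f(v))`,
  -- so passing to `|f|` keeps the norm and does not raise the form.
  have h1 : (Star.star (fun v => (ψ v : ℂ)) ⬝ᵥ S.fiberMatrix Q 0 *ᵥ (fun v => (ψ v : ℂ))).re ≤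
      (S.fiberMatrix Q 0).lowestEigenvalue * ∑ v, ‖(ψ v : ℂ)‖ ^ 2 := by
    have h2 := Matrix.star_dotProduct_mulVec_of_eigen hfe
    have hn : ∀ v, ‖(ψ v : ℂ)‖ = ‖f v‖ := fun v => by simp [hψ]
    rw [form_fiberMatrix] at h2 ⊢
    rw [lowestEigenvalue_fiberMatrix]
    simp only [hn]
    rw [← h2]
    refine sub_le_sub_left (Finset.sum_le_sum fun e _ => ?_) _
    refine mul_le_mul_of_nonneg_left ?_ (weight_nonneg e)
    refine (Complex.re_le_norm _).trans (le_of_eq ?_)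
    simp [phase_zero, hψ, ← Complex.ofReal_mul]
  have h3 := (S.fiberMatrix_isHermitian Q 0).mulVec_eq_of_rayleigh_le _ h1
  rw [lowestEigenvalue_fiberMatrix, fiberMatrix_mulVec] at h3
  have h4 := (S.eigen_real_iff Q ψ _).1 h3
  refine ⟨ψ, (S.isPositiveGroundState_of_eigen (fun v => ?_) h3).2⟩
  -- A zero would spread: where `ψ` vanishes, the eigenvalue equation makes a sum of nonnegative
  -- neighbour terms zero, so `ψ` vanishes at all neighbours.
  by_contra hv
  have hv0 : ψ v = 0 := le_antisymm (not_lt.1 hv) (norm_nonneg _)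
  refine hf (funext fun u => norm_eq_zero.1 ?_)
  refine reach_induction (p := fun u => ψ u = 0) (x := v) (y := u) (fun e he => ?_) hv0
  have h5 := h4 (G.qsrc e)
  rw [he, mul_zero] at h5
  have h6 := (Finset.sum_eq_zero_iff_of_nonneg
    (fun e' _ => mul_nonneg (weight_nonneg e') (norm_nonneg (f (G.qtgt e'))))).1 h5.symm e
    (by simp)
  exact (mul_eq_zero.1 h6).resolve_left (weight_pos hd e).ne'

theorem finrank_eigenspace_lowest (hd : 0 < d) (S : G.FundamentalSet) (Q : G.Potential) :
    Module.finrank ℂ ((S.fiber Q 0).eigenspace (S.lowest Q 0 : ℂ)) = 1 := by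
  obtain ⟨ψ, hψ⟩ := exists_isPositiveGroundState hd S Q
  refine finrank_eq_one ⟨fun v => (ψ v : ℂ), hψ.2.1⟩ (fun h => hψ.2.2 ?_) fun w => ?_
  · exact congrArg Subtype.val h
  · obtain ⟨c, hc⟩ := hψ.eq_smul hd (f := w.1) (by
      rw [fiberMatrix_mulVec]
      exact Module.End.mem_eigenspace_iff.1 w.2)
    exact ⟨c, Subtype.ext hc.symm⟩

/-- The ground state of the Laplacian is `√κ`. -/
theorem isPositiveGroundState_sqrt_degree (hd : 0 < d) (S : G.FundamentalSet) :
    S.lowest (.zero G) 0 = 0 ∧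
      S.IsPositiveGroundState (.zero G) (fun v => Real.sqrt (G.qdegree v)) := by
  refine S.isPositiveGroundState_of_eigen
    (fun v => Real.sqrt_pos.2 (by exact_mod_cast qdegree_pos hd v)) ?_
  funext x
  obtain ⟨v, rfl⟩ := exists_mkV x
  -- Working on the periodic graph makes the sum explicit: it has `κ_v` terms, each equal to `1 /
  -- √κ_v`.
  have h := S.schrodinger_extend (.zero G) 0 (fun v => (Real.sqrt (G.qdegree v) : ℂ)) v
  have he : ∀ (g : G.QVertex → ℂ) u, S.extend 0 g u = g (G.mkV u) := fun g u => by
    simp [extend, pairing_zero]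
  rw [he] at h
  rw [← h, schrodinger, laplacian]
  simp only [he, qdegree_mkV, Potential.zero]
  have hv : 0 < (G.degree v : ℝ) := by exact_mod_cast degree_pos hd v
  have hterm : ∀ e ∈ G.star v, (Real.sqrt (G.degree (G.tgt e)) : ℂ) /
      (Real.sqrt ((G.degree v : ℝ) * (G.degree (G.tgt e) : ℝ)) : ℂ) =
      (((Real.sqrt (G.degree v))⁻¹ : ℝ) : ℂ) := by
    intro e _
    have ht : 0 < (G.degree (G.tgt e) : ℝ) := by exact_mod_cast degree_pos hd (G.tgt e)
    have := (Real.sqrt_pos.2 ht).ne'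
    rw [Real.sqrt_mul hv.le, ← Complex.ofReal_div]
    congr 1
    field_simp
  rw [Finset.sum_congr rfl hterm, Finset.sum_const, nsmul_eq_mul, ← Complex.ofReal_natCast,
    ← Complex.ofReal_mul, ← div_eq_mul_inv]
  change ((_ : ℝ) : ℂ) - ((((G.degree v : ℝ)) / _ : ℝ) : ℂ) + _ = _
  rw [Real.div_sqrt]
  simp

end FundamentalSet

end PeriodicGraph

namespace PeriodicGraph

open Matrix

variable {d : ℕ} {V A : Type*} [AddAction (Fin d → ℤ) V] [AddAction (Fin d → ℤ) A]
  {G : PeriodicGraph d V A}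

namespace FundamentalSet

variable (S : G.FundamentalSet)

/-! ### A lower bound for the first band function of the Laplacian -/

/-- The phase of the initial vertex factors out, so an energy term is a plain difference across a
lifted edge. -/
theorem extend_src_sub_extend_tgt (θ : Fin d → ℝ) (g : G.QVertex → ℂ) (e : A) :
    ‖S.extend θ g (G.src e) - S.extend θ g (G.tgt e)‖ =
      ‖g (G.qsrc (G.mkE e)) - S.phase θ (G.mkE e) * g (G.qtgt (G.mkE e))‖ := by
  have h : Complex.exp (Complex.I * (pairing (S.coord (G.tgt e)) θ : ℂ)) =
      Complex.exp (Complex.I * (pairing (S.coord (G.src e)) θ : ℂ)) * S.phase θ (G.mkE e) := by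
    rw [phase, ← Complex.exp_add, S.qindex_mkE, pairing_sub]
    congr 1
    push_cast
    ring
  rw [extend, extend, h, mul_assoc, ← mul_sub, norm_mul, norm_exp_I_mul, one_mul]
  rfl

/-- Telescoping along a path; `C` is its length, hence independent of `θ` and `g`. -/
theorem exists_norm_extend_sub_le (u v : V) : ∃ C : ℝ, 0 ≤ C ∧
    ∀ (θ : Fin d → ℝ) (g : G.QVertex → ℂ), ‖S.extend θ g u - S.extend θ g v‖ ≤
      C * ∑ e, ‖g (G.qsrc e) - S.phase θ e * g (G.qtgt e)‖ := by
  induction G.connected u v with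
  | refl => exact ⟨0, le_rfl, fun θ g => by simp⟩
  | tail _ hbc ih =>
    obtain ⟨C, hC, h⟩ := ih
    obtain ⟨e, rfl, rfl⟩ := hbc
    refine ⟨C + 1, by linarith, fun θ g => ?_⟩
    have h1 := norm_sub_le_norm_sub_add_norm_sub (S.extend θ g u) (S.extend θ g (G.src e))
      (S.extend θ g (G.tgt e))
    have h2 := h θ g
    have h3 : ‖S.extend θ g (G.src e) - S.extend θ g (G.tgt e)‖ ≤
        ∑ e, ‖g (G.qsrc e) - S.phase θ e * g (G.qtgt e)‖ := by
      rw [extend_src_sub_extend_tgt]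
      exact Finset.single_le_sum
        (f := fun e => ‖g (G.qsrc e) - S.phase θ e * g (G.qtgt e)‖)
        (fun _ _ => norm_nonneg _) (Finset.mem_univ (G.mkE e))
    linarith

theorem norm_extend (θ : Fin d → ℝ) (g : G.QVertex → ℂ) (v : V) :
    ‖S.extend θ g v‖ = ‖g (G.mkV v)‖ := by
  rw [extend, norm_mul, norm_exp_I_mul, one_mul]

theorem extend_vadd (θ : Fin d → ℝ) (g : G.QVertex → ℂ) (m : Fin d → ℤ) (v : V) :
    S.extend θ g (m +ᵥ v) = Complex.exp (Complex.I * (pairing m θ : ℂ)) * S.extend θ g v := by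
  have h : G.mkV (m +ᵥ v) = G.mkV v := G.mkV_eq.2 ⟨m, rfl⟩
  rw [extend, extend, S.coord_vadd, pairing_add, h, Complex.ofReal_add, mul_add, Complex.exp_add,
    mul_assoc]

theorem pairing_single (i : Fin d) (θ : Fin d → ℝ) : pairing (Pi.single i 1) θ = θ i := by
  rw [pairing, Finset.sum_eq_single i]
  · simp
  · intro j _ hj
    simp [hj]
  · simp

theorem norm_sq_exp_sub_one (t : ℝ) :
    ‖Complex.exp (Complex.I * (t : ℂ)) - 1‖ ^ 2 = 2 * (1 - Real.cos t) := by
  rw [mul_comm, Complex.exp_mul_I, ← Complex.normSq_eq_norm_sq, Complex.normSq_apply]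
  simp only [← Complex.ofReal_cos, ← Complex.ofReal_sin, Complex.sub_re, Complex.add_re,
    Complex.ofReal_re, Complex.mul_re, Complex.I_re, Complex.ofReal_im, Complex.I_im,
    Complex.one_re, Complex.sub_im, Complex.add_im, Complex.mul_im, Complex.one_im]
  have := Real.sin_sq_add_cos_sq t
  ring_nf
  linarith

/-- The first band function of the Laplacian dominates a multiple of `1 - cos θ_i`. -/
theorem exists_le_lowest_zero (hd : 0 < d) : ∃ c : ℝ, 0 < c ∧ ∀ (θ : Fin d → ℝ) (i : Fin d),
    c * (1 - Real.cos (θ i)) ≤ S.lowest (.zero G) θ := by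
  choose C hC0 hC using fun (x : G.QVertex) (i : Fin d) =>
    S.exists_norm_extend_sub_le ((Pi.single i 1 : Fin d → ℤ) +ᵥ S.rep x) (S.rep x)
  set D : ℝ := ∑ x, ∑ i, C x i with hD
  have hDle : ∀ x i, C x i ≤ D := fun x i =>
    (Finset.single_le_sum (f := fun i => C x i) (fun j _ => hC0 x j) (Finset.mem_univ i)).trans
      (Finset.single_le_sum (f := fun x => ∑ i, C x i)
        (fun y _ => Finset.sum_nonneg fun j _ => hC0 y j) (Finset.mem_univ x))
  obtain ⟨h0, hψ⟩ := isPositiveGroundState_sqrt_degree hd S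
  set ψ : G.QVertex → ℝ := fun v => Real.sqrt (G.qdegree v) with hψdef
  set N : ℝ := ((Fintype.card G.QEdge : ℕ) : ℝ) with hN
  set K : ℝ := ∑ v, ψ v ^ 2 with hK
  have hKnn : 0 ≤ K := Finset.sum_nonneg fun _ _ => sq_nonneg _
  -- The final estimate has the constant `D² N K`; adding `1` only ensures positivity.
  refine ⟨(D ^ 2 * N * K + 1)⁻¹, by positivity, fun θ i => ?_⟩
  obtain ⟨g, hg, he⟩ := hψ.exists_energy_eq θ
  rw [h0, sub_zero] at he
  have hpsi : ∀ e, G.psiWeight ψ e = 1 := by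
    intro e
    have h1 : 0 < (G.qdegree (G.qsrc e) : ℝ) := by exact_mod_cast qdegree_pos hd _
    have h2 : 0 < (G.qdegree (G.qtgt e) : ℝ) := by exact_mod_cast qdegree_pos hd _
    simp only [psiWeight, weight, hψdef]
    rw [← Real.sqrt_mul h1.le, inv_mul_cancel₀]
    exact (Real.sqrt_pos.2 (mul_pos h1 h2)).ne'
  have hen : S.energy (G.psiWeight ψ) θ g =
      ∑ e, ‖g (G.qsrc e) - S.phase θ e * g (G.qtgt e)‖ ^ 2 := by
    simp [energy, hpsi]
  set E : ℝ := ∑ e, ‖g (G.qsrc e) - S.phase θ e * g (G.qtgt e)‖ ^ 2 with hE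
  -- Translation by the `i`-th basis vector multiplies the extension by `e^{iθ_i}`. Squaring the
  -- path estimate and applying Cauchy-Schwarz over the `N` edges gives the bound.
  have hpt : ∀ x, 2 * (1 - Real.cos (θ i)) * ‖g x‖ ^ 2 ≤ D ^ 2 * N * E := by
    intro x
    have h1 := (hC x i θ g).trans (mul_le_mul_of_nonneg_right (hDle x i)
      (Finset.sum_nonneg fun _ _ => norm_nonneg _))
    rw [extend_vadd, pairing_single, ← sub_one_mul, norm_mul, norm_extend, S.mkV_rep] at h1
    have h2 := pow_le_pow_left₀ (by positivity) h1 2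
    rw [mul_pow, norm_sq_exp_sub_one, mul_pow] at h2
    have h3 := sq_sum_le_card_mul_sum_sq (s := Finset.univ)
      (f := fun e => ‖g (G.qsrc e) - S.phase θ e * g (G.qtgt e)‖)
    rw [Finset.card_univ] at h3
    calc _ ≤ _ := h2
      _ ≤ D ^ 2 * (N * E) := by gcongr
      _ = _ := by ring
  set M : ℝ := ∑ v, ψ v ^ 2 * ‖g v‖ ^ 2 with hM
  have hMpos : 0 < M := sum_sq_mul_norm_pos hψ.1 hg
  have hsum : 2 * (1 - Real.cos (θ i)) * M ≤ D ^ 2 * N * E * K := by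
    rw [hM, hK, Finset.mul_sum, Finset.mul_sum]
    refine Finset.sum_le_sum fun v _ => ?_
    have := mul_le_mul_of_nonneg_left (hpt v) (sq_nonneg (ψ v))
    linarith
  have hEM : E = 2 * (S.lowest (.zero G) θ * M) := by rw [he, hen]; ring
  rw [hEM] at hsum
  have hcos : 1 - Real.cos (θ i) ≤ D ^ 2 * N * K * S.lowest (.zero G) θ := by
    refine le_of_mul_le_mul_right ?_ hMpos
    linarith
  have hnn : 0 ≤ S.lowest (.zero G) θ := by
    have := hψ.lowest_zero_le θ
    rwa [h0] at this
  rw [inv_mul_le_iff₀ (by positivity)]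
  linarith

/-! ### Regularity and periodicity of the first band function -/

theorem contDiff_fiberMatrix (Q : G.Potential) (k : ℕ∞) (v u : G.QVertex) :
    ContDiff ℝ k fun θ => S.fiberMatrix Q θ v u := by
  simp only [fiberMatrix_apply]
  refine contDiff_const.sub (ContDiff.sum fun e _ => ?_)
  split_ifs
  · refine ContDiff.mul ?_ contDiff_const
    refine ContDiff.cexp (contDiff_const.mul (Complex.ofRealCLM.contDiff.comp ?_))
    change ContDiff ℝ k fun θ : Fin d → ℝ => ∑ i, (S.qindex e i : ℝ) * θ i
    fun_prop
  · exact contDiff_const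

theorem continuous_lowest (Q : G.Potential) : Continuous (S.lowest Q) := by
  have := Matrix.continuous_lowestEigenvalue (S.fiberMatrix_isHermitian Q)
    (continuous_matrix fun i j => (S.contDiff_fiberMatrix Q 0 i j).continuous)
  simpa only [lowestEigenvalue_fiberMatrix] using this

theorem contDiffAt_lowest (hd : 0 < d) (Q : G.Potential) {k : ℕ∞} (hk : k ≠ 0) :
    ContDiffAt ℝ k (S.lowest Q) 0 := by
  obtain ⟨ψ, hψ⟩ := exists_isPositiveGroundState hd S Q
  have := Matrix.contDiffAt_lowestEigenvalue (a := 0) hk (S.fiberMatrix_isHermitian Q)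
    (S.contDiff_fiberMatrix Q k) (φ := fun v => (ψ v : ℂ)) (fun f hf => hψ.eq_smul hd (by
      rwa [lowestEigenvalue_fiberMatrix] at hf))
  simpa only [lowestEigenvalue_fiberMatrix] using this

theorem phase_add_period (θ : Fin d → ℝ) (m : Fin d → ℤ) (e : G.QEdge) :
    S.phase (fun i => θ i + m i * (2 * Real.pi)) e = S.phase θ e := by
  have h : pairing (S.qindex e) (fun i => θ i + m i * (2 * Real.pi)) =
      pairing (S.qindex e) θ + ((∑ i, S.qindex e i * m i : ℤ) : ℝ) * (2 * Real.pi) := by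
    simp only [pairing, mul_add, Finset.sum_add_distrib]
    push_cast
    rw [Finset.sum_mul]
    congr 1
    exact Finset.sum_congr rfl fun i _ => by ring
  rw [phase, phase, h, Complex.exp_eq_exp_iff_exists_int]
  refine ⟨∑ i, S.qindex e i * m i, ?_⟩
  push_cast
  ring

theorem lowest_add_period (Q : G.Potential) (θ : Fin d → ℝ) (m : Fin d → ℤ) :
    S.lowest Q (fun i => θ i + m i * (2 * Real.pi)) = S.lowest Q θ := by
  rw [← lowestEigenvalue_fiberMatrix, ← lowestEigenvalue_fiberMatrix]
  congr 1
  ext v u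
  simp only [fiberMatrix_apply, phase_add_period]

/-- Periodicity replaces `ℝ^d` by a compact cube, from which the maximum of the band is obtained. -/
theorem firstBand_eq_image (Q : G.Potential) :
    S.firstBand Q = S.lowest Q '' Set.Icc 0 (fun _ => 2 * Real.pi) := by
  refine Set.Subset.antisymm ?_ (Set.image_subset_range _ _)
  rintro _ ⟨θ, rfl⟩
  have hp := Real.two_pi_pos
  refine ⟨fun i => θ i + ((-⌊θ i / (2 * Real.pi)⌋ : ℤ) : ℝ) * (2 * Real.pi), ⟨?_, ?_⟩,
    S.lowest_add_period Q θ fun i => -⌊θ i / (2 * Real.pi)⌋⟩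
  · intro i
    have := (le_div_iff₀ hp).1 (Int.floor_le (θ i / (2 * Real.pi)))
    simp only [Pi.zero_apply]
    push_cast
    linarith
  · intro i
    have := (div_lt_iff₀ hp).1 (Int.lt_floor_add_one (θ i / (2 * Real.pi)))
    push_cast
    linarith

variable {S}

theorem IsPositiveGroundState.exists_firstBand_eq {Q : G.Potential} {ψ : G.QVertex → ℝ}
    (h : S.IsPositiveGroundState Q ψ) :
    ∃ θ, S.firstBand Q = Set.Icc (S.lowest Q 0) (S.lowest Q θ) ∧
      ∀ η, S.lowest Q η ≤ S.lowest Q θ := by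
  have hcpt : IsCompact (S.firstBand Q) := by
    rw [firstBand_eq_image]
    exact isCompact_Icc.image (S.continuous_lowest Q)
  have hconn : IsConnected (S.firstBand Q) := isConnected_range (S.continuous_lowest Q)
  obtain ⟨_, ⟨θ, rfl⟩, hmax⟩ := hcpt.exists_isGreatest hconn.nonempty
  refine ⟨θ, Set.Subset.antisymm ?_ ?_, fun η => hmax ⟨η, rfl⟩⟩
  · rintro _ ⟨η, rfl⟩
    exact ⟨h.lowest_zero_le η, hmax ⟨η, rfl⟩⟩
  · exact hconn.isPreconnected.Icc_subset ⟨0, rfl⟩ ⟨θ, rfl⟩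

theorem firstBandLength_eq {Q : G.Potential} {a b : ℝ} (hab : a ≤ b)
    (h : S.firstBand Q = Set.Icc a b) : S.firstBandLength Q = b - a := by
  rw [firstBandLength, h, Real.volume_real_Icc_of_le hab]

/-- Both bands start at `θ = 0`, so the hypothesis at a maximizer for `Q` suffices. -/
theorem IsPositiveGroundState.firstBandLength_le {P Q : G.Potential} {φ ψ : G.QVertex → ℝ}
    (hP : S.IsPositiveGroundState P φ) (hQ : S.IsPositiveGroundState Q ψ) {C : ℝ} (hC : 0 ≤ C)
    (h : ∀ θ, S.lowest Q θ - S.lowest Q 0 ≤ C * (S.lowest P θ - S.lowest P 0)) :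
    S.firstBandLength Q ≤ C * S.firstBandLength P := by
  obtain ⟨θ, hθ, -⟩ := hQ.exists_firstBand_eq
  obtain ⟨η, hη, hmax⟩ := hP.exists_firstBand_eq
  rw [firstBandLength_eq (hQ.lowest_zero_le θ) hθ, firstBandLength_eq (hP.lowest_zero_le η) hη]
  refine (h θ).trans (mul_le_mul_of_nonneg_left ?_ hC)
  linarith [hmax θ]

/-! ### The Hessian of the first band function -/

theorem massHessian_apply {Q : G.Potential} (h : ContDiffAt ℝ 2 (S.lowest Q) 0) (i j : Fin d) :
    S.massHessian Q i j =
      fderiv ℝ (fderiv ℝ (S.lowest Q)) 0 (Pi.single i 1) (Pi.single j 1) := by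
  have h1 : DifferentiableAt ℝ (fderiv ℝ (S.lowest Q)) 0 :=
    (h.fderiv_right (m := 1) (by norm_num)).differentiableAt (by simp)
  rw [massHessian, Matrix.of_apply, fderiv_clm_apply h1 (differentiableAt_const _)]
  simp

theorem massHessian_isHermitian {Q : G.Potential} (h : ContDiffAt ℝ 2 (S.lowest Q) 0) :
    (S.massHessian Q).IsHermitian := by
  ext i j
  rw [conjTranspose_apply, massHessian_apply h, massHessian_apply h, star_trivial]
  exact (h.isSymmSndFDerivAt (by simp)) _ _

theorem dotProduct_massHessian {Q : G.Potential} (h : ContDiffAt ℝ 2 (S.lowest Q) 0)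
    (x : Fin d → ℝ) :
    x ⬝ᵥ S.massHessian Q *ᵥ x = fderiv ℝ (fderiv ℝ (S.lowest Q)) 0 x x := by
  conv_rhs => rw [pi_eq_sum_univ' x]
  simp only [map_sum, map_smul, _root_.sum_apply, _root_.smul_apply,
    dotProduct, mulVec, massHessian_apply h, smul_eq_mul, Finset.mul_sum]
  refine Finset.sum_congr rfl fun i _ => Finset.sum_congr rfl fun j _ => ?_
  rw [h.isSymmSndFDerivAt (by simp) (Pi.single i 1)]
  ring

theorem posSemidef_smul_massHessian_sub {P Q : G.Potential}
    (hP : ContDiffAt ℝ 2 (S.lowest P) 0) (hQ : ContDiffAt ℝ 2 (S.lowest Q) 0) {C : ℝ}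
    (h : ∀ θ, S.lowest Q θ - S.lowest Q 0 ≤ C * (S.lowest P θ - S.lowest P 0)) :
    (C • S.massHessian P - S.massHessian Q).PosSemidef := by
  refine .of_dotProduct_mulVec_nonneg
    (((massHessian_isHermitian hP).smul (star_trivial C)).sub (massHessian_isHermitian hQ))
    fun x => ?_
  rw [star_trivial, sub_mulVec, smul_mulVec, dotProduct_sub, dotProduct_smul,
    dotProduct_massHessian hP, dotProduct_massHessian hQ, smul_eq_mul, sub_nonneg]
  exact fderiv_fderiv_le_of_le hP hQ h x

/-- Along `t ↦ t x` the function `c (1 - cos (t x_i))` touches `λ₁` from below at `0` and has second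
derivative `c x_i²` there; `i` is chosen with `x_i ≠ 0`. -/
theorem posDef_massHessian_zero (hd : 0 < d) (S : G.FundamentalSet) :
    (S.massHessian (.zero G)).PosDef := by
  obtain ⟨c, hc, hle⟩ := S.exists_le_lowest_zero hd
  have h2 : ContDiffAt ℝ 2 (S.lowest (.zero G)) 0 := S.contDiffAt_lowest hd _ (k := 2) (by simp)
  refine .of_dotProduct_mulVec_pos (massHessian_isHermitian h2) fun x hx => ?_
  rw [star_trivial, dotProduct_massHessian h2]
  obtain ⟨i, hi⟩ := Function.ne_iff.1 hx
  have hi' : 0 < (x i) ^ 2 := by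
    have : x i ≠ 0 := hi
    positivity
  refine lt_of_lt_of_le (mul_pos hc hi') (le_fderiv_fderiv_of_touching h2 x
    (g := fun t => c * (1 - Real.cos (t * x i))) (g' := fun t => c * (Real.sin (t * x i) * x i))
    (fun t => ?_) ?_ fun t => ?_)
  · have h1 : HasDerivAt (fun t : ℝ => t * x i) (x i) t := hasDerivAt_mul_const _
    exact ((h1.cos.const_sub 1).const_mul c).congr_deriv (by ring)
  · have h1 : HasDerivAt (fun t : ℝ => t * x i) (x i) 0 := hasDerivAt_mul_const _
    refine ((h1.sin.mul_const (x i)).const_mul c).congr_deriv ?_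
    rw [zero_mul, Real.cos_zero]
    ring
  · have h0 := (isPositiveGroundState_sqrt_degree hd S).1
    have := hle (t • x) i
    rw [h0]
    simpa using this

end FundamentalSet

/-! ### The constant `c₀` -/

theorem psiMinus_le {ψ : G.QVertex → ℝ} (v : G.QVertex) :
    G.psiMinus ψ ≤ ψ v / Real.sqrt (G.qdegree v) :=
  ciInf_le (Set.finite_range _).bddBelow v

theorem le_psiPlus {ψ : G.QVertex → ℝ} (v : G.QVertex) :
    ψ v / Real.sqrt (G.qdegree v) ≤ G.psiPlus ψ :=
  le_ciSup (f := fun v => ψ v / Real.sqrt (G.qdegree v)) (Set.finite_range _).bddAbove v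

theorem psiMinus_pos (hd : 0 < d) {ψ : G.QVertex → ℝ} (h : ∀ v, 0 < ψ v) :
    0 < G.psiMinus ψ := by
  obtain ⟨v, hv⟩ := exists_eq_ciInf_of_finite (f := fun v => ψ v / Real.sqrt (G.qdegree v))
  rw [psiMinus, ← hv]
  exact div_pos (h v) (Real.sqrt_pos.2 (by exact_mod_cast qdegree_pos hd v))

theorem psiPlus_pos (hd : 0 < d) {ψ : G.QVertex → ℝ} (h : ∀ v, 0 < ψ v) : 0 < G.psiPlus ψ :=
  (psiMinus_pos hd h).trans_le
    ((psiMinus_le (Classical.arbitrary _)).trans (le_psiPlus _))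

theorem cZero_pos (hd : 0 < d) {ψ : G.QVertex → ℝ} (h : ∀ v, 0 < ψ v) : 0 < G.cZero ψ :=
  div_pos (psiPlus_pos hd h) (psiMinus_pos hd h)

namespace FundamentalSet

variable {S : G.FundamentalSet}

theorem IsPositiveGroundState.lowest_sub_le_cZero (hd : 0 < d) {Q : G.Potential}
    {ψ : G.QVertex → ℝ} (h : S.IsPositiveGroundState Q ψ) (θ : Fin d → ℝ) :
    S.lowest Q θ - S.lowest Q 0 ≤
      G.cZero ψ ^ 2 * (S.lowest (.zero G) θ - S.lowest (.zero G) 0) := by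
  have hk : ∀ v, 0 < Real.sqrt (G.qdegree v) := fun v =>
    Real.sqrt_pos.2 (by exact_mod_cast qdegree_pos hd v)
  exact (isPositiveGroundState_sqrt_degree hd S).2.lowest_sub_le h (psiMinus_pos hd h.1)
    (fun v => (le_div_iff₀ (hk v)).1 (psiMinus_le v))
    (fun v => (div_le_iff₀ (hk v)).1 (le_psiPlus v)) θ

/-- With the roles exchanged, `√κ` lies between `ψ / ψ₊` and `ψ / ψ₋`, and the ratio of the
constants is again `c₀`. -/
theorem IsPositiveGroundState.lowest_zero_sub_le_cZero (hd : 0 < d) {Q : G.Potential}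
    {ψ : G.QVertex → ℝ} (h : S.IsPositiveGroundState Q ψ) (θ : Fin d → ℝ) :
    S.lowest (.zero G) θ - S.lowest (.zero G) 0 ≤
      G.cZero ψ ^ 2 * (S.lowest Q θ - S.lowest Q 0) := by
  have hk : ∀ v, 0 < Real.sqrt (G.qdegree v) := fun v =>
    Real.sqrt_pos.2 (by exact_mod_cast qdegree_pos hd v)
  have hm := psiMinus_pos hd h.1
  have hp := psiPlus_pos hd h.1
  have := h.lowest_sub_le (isPositiveGroundState_sqrt_degree hd S).2 (inv_pos.2 hp)
    (b := (G.psiMinus ψ)⁻¹)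
    (fun v => by
      rw [inv_mul_le_iff₀ hp]
      exact (div_le_iff₀ (hk v)).1 (le_psiPlus v))
    (fun v => by
      rw [le_inv_mul_iff₀ hm]
      exact (le_div_iff₀ (hk v)).1 (psiMinus_le v)) θ
  rwa [inv_div_inv] at this

theorem posDef_massHessian (hd : 0 < d) (S : G.FundamentalSet) (Q : G.Potential) :
    (S.massHessian Q).PosDef := by
  obtain ⟨ψ, hψ⟩ := exists_isPositiveGroundState hd S Q
  have h2 : ∀ P, ContDiffAt ℝ 2 (S.lowest P) 0 := fun P =>
    S.contDiffAt_lowest hd P (k := 2) (by simp)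
  have hc := pow_pos (cZero_pos hd hψ.1) 2
  have h1 := posSemidef_smul_massHessian_sub (h2 Q) (h2 _) (hψ.lowest_zero_sub_le_cZero hd)
  -- Here `c₀² M` is the positive definite Hessian of `Δ` plus a positive semidefinite remainder.
  have h3 := ((posDef_massHessian_zero hd S).add_posSemidef h1).smul (inv_pos.2 hc)
  rwa [add_sub_cancel, smul_smul, inv_mul_cancel₀ hc.ne', one_smul] at h3

/-- At `(π, …, π)` the cosine bound gives at least `2c > 0` for `Δ`, which the comparison carries
over to `H`. -/
theorem IsPositiveGroundState.lowest_zero_lt {Q : G.Potential} (hd : 0 < d) {ψ : G.QVertex → ℝ}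
    (h : S.IsPositiveGroundState Q ψ) :
    S.lowest Q 0 < S.lowest Q fun _ => Real.pi := by
  obtain ⟨c, hc, hle⟩ := S.exists_le_lowest_zero hd
  have h1 := hle (fun _ => Real.pi) ⟨0, hd⟩
  have h2 := h.lowest_zero_sub_le_cZero hd fun _ => Real.pi
  rw [(isPositiveGroundState_sqrt_degree hd S).1] at h2
  rw [Real.cos_pi] at h1
  have h3 := pow_pos (cZero_pos hd h.1) 2
  by_contra! h4
  nlinarith

end FundamentalSet

end PeriodicGraph

/-! ### The theorem, assembled from the pointwise comparison. -/

theorem theorem2p1 {d : ℕ} (hd : 2 ≤ d) {V A : Type*}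
    [AddAction (Fin d → ℤ) V] [AddAction (Fin d → ℤ) A]
    (G : PeriodicGraph d V A) (S : G.FundamentalSet) (Q : G.Potential) :
    -- i) the lowest eigenvalue of `H(0)` is simple and has a positive eigenvector
    (IsLeast (S.eigenvalues Q 0) (S.lowest Q 0) ∧
      Module.finrank ℂ ((S.fiber Q 0).eigenspace (S.lowest Q 0 : ℂ)) = 1 ∧
      ∃ ψ, S.IsPositiveGroundState Q ψ) ∧
    -- ii) the first band is a non-degenerate closed interval, with a two-sided length estimate
    ((∃ a b : ℝ, a < b ∧ S.firstBand Q = Set.Icc a b) ∧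
      ∀ ψ, S.IsPositiveGroundState Q ψ →
        (G.cZero ψ ^ 2)⁻¹ * S.firstBandLength (.zero G) ≤ S.firstBandLength Q ∧
        S.firstBandLength Q ≤ G.cZero ψ ^ 2 * S.firstBandLength (.zero G)) ∧
    -- iii) the effective mass tensors of `H` and `Δ` exist, with a two-sided estimate
    ((∀ P ∈ ({Q, .zero G} : Set G.Potential),
        ContDiffAt ℝ 3 (S.lowest P) 0 ∧ IsUnit (S.massHessian P).det) ∧
      ∀ ψ, S.IsPositiveGroundState Q ψ →
        (S.effectiveMass Q - (G.cZero ψ ^ 2)⁻¹ • S.effectiveMass (.zero G)).PosSemidef ∧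
        (G.cZero ψ ^ 2 • S.effectiveMass (.zero G) - S.effectiveMass Q).PosSemidef) := by
  have hd0 : 0 < d := by omega
  have hzero := (PeriodicGraph.FundamentalSet.isPositiveGroundState_sqrt_degree hd0 S).2
  have hC2 : ∀ P, ContDiffAt ℝ 2 (S.lowest P) 0 := fun P =>
    S.contDiffAt_lowest hd0 P (k := 2) (by simp)
  have hpd := S.posDef_massHessian hd0
  obtain ⟨ψ₀, hψ₀⟩ := PeriodicGraph.FundamentalSet.exists_isPositiveGroundState hd0 S Q
  refine ⟨⟨S.isLeast_lowest Q 0, S.finrank_eigenspace_lowest hd0 Q, ψ₀, hψ₀⟩, ⟨?_, ?_⟩, ?_, ?_⟩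
  · obtain ⟨θ, hθ, hmax⟩ := hψ₀.exists_firstBand_eq
    exact ⟨_, _, (hψ₀.lowest_zero_lt hd0).trans_le (hmax _), hθ⟩
  · intro ψ hψ
    have hc := pow_pos (PeriodicGraph.cZero_pos hd0 hψ.1) 2
    refine ⟨?_, hzero.firstBandLength_le hψ hc.le (hψ.lowest_sub_le_cZero hd0)⟩
    rw [inv_mul_le_iff₀ hc]
    exact hψ.firstBandLength_le hzero hc.le (hψ.lowest_zero_sub_le_cZero hd0)
  · intro P _
    exact ⟨S.contDiffAt_lowest hd0 P (k := 3) (by simp), (hpd P).det_pos.ne'.isUnit⟩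
  · intro ψ hψ
    have hc := pow_pos (PeriodicGraph.cZero_pos hd0 hψ.1) 2
    have hinv : ∀ P, (G.cZero ψ ^ 2 • S.massHessian P)⁻¹ =
        (G.cZero ψ ^ 2)⁻¹ • (S.massHessian P)⁻¹ := fun P =>
      Matrix.inv_smul' _ (Units.mk0 _ hc.ne') (hpd P).det_pos.ne'.isUnit
    -- Inversion swaps the sides: the upper bound on `M` gives the lower bound on `m`, and the lower
    -- bound on `M` gives the upper bound.
    have h1 := (hpd Q).posSemidef_inv_sub_inv ((hpd (.zero G)).smul hc)
      (PeriodicGraph.FundamentalSet.posSemidef_smul_massHessian_sub (hC2 _) (hC2 _)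
        (hψ.lowest_sub_le_cZero hd0))
    have h2 := (hpd (.zero G)).posSemidef_inv_sub_inv ((hpd Q).smul hc)
      (PeriodicGraph.FundamentalSet.posSemidef_smul_massHessian_sub (hC2 _) (hC2 _)
        (hψ.lowest_zero_sub_le_cZero hd0))
    rw [hinv] at h1 h2
    refine ⟨h1, ?_⟩
    have h3 := h2.smul hc.le
    rwa [smul_sub, smul_smul, mul_inv_cancel₀ hc.ne', one_smul] at h3
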